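/- **Setting.** Let $n,m\in\mathbb N$. On $L^2(\mathbb R^n)$ let $P_i$ be the closure of $i\,\partial/\partial x^i$ on $\mathscr S(\mathbb R^n)$ $(1\le i\le n)$. Let $Z:\mathbb R^n\to\mathbb R^n$ be a Borel map that is $C^1$ on some open set with Lebesgue-null complement; $Z(\mathbf X)^k$ is multiplication by $Z(x)^k$. Let $\tau^\alpha$, $1\le\alpha\le m^2-1$, be infinitesimal generators of $SU(m)$ (linearly independent traceless Hermitian $m\times m$ matrices), and let $Y_\alpha$ be real numbers, or more generally complex $m\times m$ matrices, such that $Y_\alpha\tau^\alpha$ (summed over $\alpha$) is Hermitian. Let $\Theta=(\Theta_{kl})$ be a real skew-symmetric $n\times n$ matrix, $(\Theta x)_k=\sum_l\Theta_{kl}x^l$, let $q\in\mathbb R\setminus\{0\}$, and write $xy=\sum_k x^k y_k$. Put $$U(y)=e^{i\sum_k y_kZ(\mathbf X)^k},\qquad U^\tau(p)=e^{i\sum_k p_kZ(\mathbf X)^k\otimes Y_\alpha\tau^\alpha},\qquad \alpha^\tau_{p}(A)=U^\tau(p)\,(A\otimes 1)\,U^\tau(p)^{-1},$$ the last two on $L^2(\mathbb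 R^n)\otimes\mathbb C^m$; there $U(y)$ also stands for $U(y)\otimes1$. The non-abelian warped convolutions $A^{\Theta_\tau}$ and ${}_{\Theta_\tau}A$ of a (possibly unbounded) operator $A$ on $L^2(\mathbb R^n)$, with generator $Q_k=Z(\mathbf X)_k\otimes Y_\alpha\tau^\alpha$, are defined by $$A^{\Theta_\tau}\Phi=(2\pi)^{-n}\lim_{\varepsilon\downarrow0}\iint dx\,dy\,\chi(\varepsilon x,\varepsilon y)\,e^{-ixy}\,U(y)\,\alpha^\tau_{\Theta x}(A)\Phi,$$ $${}_{\Theta_\tau}A\,\Phi=(2\pi)^{-n}\lim_{\varepsilon\downarrow0}\iint dx\,dy\,\chi(\varepsilon x,\varepsilon y)\,e^{-ixy}\,\alpha^\tau_{\Theta x}(A)\,U(y)\Phi .$$ Such an expression is *well-defined* at $\Phi$ if all vectors to which an operator is applied lie in its domain and if, for every $\chi\in\mathscr S(\mathbb R^n\times\mathbb R^n)$ with $\chi(0,0)=1$, the integrals converge absolutely in norm for all $\varepsilon>0$ and the limit exists in norm and does not depend on $\chi$. Let $\mathcal E\subseteq\mathscr S(\mathbb R^n)$ be the space of all Schwartz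 functions $\varphi$ such that for every $i$ one has $U(y)\varphi\in D(P_i)$ for all $y\in\mathbb R^n$, and $y\mapsto U(y)\varphi$ and $y\mapsto P_iU(y)\varphi$ are $C^\infty$ in norm. **Proposition.** $\mathcal E\otimes\mathbb C^m$ is dense in $L^2(\mathbb R^n)\otimes\mathbb C^m$. For every $i$, both deformed momentum operators $P_i^{\Theta_\tau}$ and ${}_{\Theta_\tau}P_i$ are well-defined on $\mathcal E\otimes\mathbb C^m$, coincide there, and $$P_i^{\Theta_\tau}\Phi=\bigl(P_i\otimes 1-q\,A_{i,\alpha}\tau^\alpha\bigr)\Phi,\qquad \Phi\in\mathcal E\otimes\mathbb C^m,$$ where the gauge field is given by $$-q\,A_{i,\alpha}=\sum_k(\Theta Z(\mathbf X))_k\,\partial_iZ(\mathbf X)^k\otimes Y_\alpha ;$$ in particular $\mathcal E\otimes\mathbb C^m$ lies in the domain of the operator on the right. -/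

import Mathlib

open MeasureTheory Filter Topology Complex
open scoped ENNReal ContDiff LineDeriv SchwartzMap Matrix

noncomputable section

namespace NAWarped

/-- Configuration space `ℝⁿ`. -/
abbrev Pos (n : ℕ) : Type := EuclideanSpace ℝ (Fin n)

/-- The internal space `ℂᵐ`. -/
abbrev Fib (m : ℕ) : Type := EuclideanSpace ℂ (Fin m)

/-- The Schrödinger Hilbert space `L²(ℝⁿ)`. -/
abbrev Hil (n : ℕ) : Type := Lp ℂ 2 (volume : Measure (Pos n))

/-- The Hilbert space `L²(ℝⁿ) ⊗ ℂᵐ`, realized as `L²(ℝⁿ; ℂᵐ)`. -/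
abbrev HilT (n m : ℕ) : Type := Lp (Fib m) 2 (volume : Measure (Pos n))

/-- The pairing `p_k x^k`. -/
def pairing {n : ℕ} (p x : Pos n) : ℝ := ∑ k, p k * x k

/-! ### The momentum operator -/

/-- The operator `i ∂/∂x^i` with domain the Schwartz space. -/
def momentumCore {n : ℕ} (i : Fin n) : Hil n →ₗ.[ℂ] Hil n where
  domain := LinearMap.range
    (SchwartzMap.toLpCLM ℂ ℂ 2 (volume : Measure (Pos n))).toLinearMap
  toFun :=
    (I • ((SchwartzMap.toLpCLM ℂ ℂ 2 (volume : Measure (Pos n))).toLinearMap ∘ₗ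
        (LineDeriv.lineDerivOpCLM ℂ 𝓢(Pos n, ℂ)
          (EuclideanSpace.single i (1 : ℝ))).toLinearMap)) ∘ₗ
      (LinearEquiv.ofInjective
        (SchwartzMap.toLpCLM ℂ ℂ 2 (volume : Measure (Pos n))).toLinearMap
        (SchwartzMap.injective_toLp 2 volume)).symm.toLinearMap

/-- The momentum operator `P_i`: the closure of `i ∂/∂x^i` on the Schwartz space. -/
def momentum {n : ℕ} (i : Fin n) : Hil n →ₗ.[ℂ] Hil n := (momentumCore i).closure

/-! ### Multiplication operators -/

section Exp

variable {F : Type*} [NormedAddCommGroup F] [InnerProductSpace ℂ F] [CompleteSpace F]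

/-- The unitary `exp (i r M)` on the fibre. -/
def fibUnitary (M : selfAdjoint (F →L[ℂ] F)) (r : ℝ) : unitary (F →L[ℂ] F) :=
  selfAdjoint.expUnitary ⟨(r : ℂ) • (M : F →L[ℂ] F), by
    rw [selfAdjoint.mem_iff, star_smul, selfAdjoint.mem_iff.1 M.2]
    congr 1
    exact Complex.conj_ofReal r⟩

theorem continuous_fibUnitary (M : selfAdjoint (F →L[ℂ] F)) :
    Continuous fun r : ℝ => (fibUnitary M r : F →L[ℂ] F) := by
  refine continuous_subtype_val.comp (selfAdjoint.continuous_expUnitary.comp ?_)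
  refine Continuous.subtype_mk ?_ _
  exact Complex.continuous_ofReal.smul continuous_const

/-- `exp (i r M)` as an isometric automorphism of the fibre. -/
def fibExp (M : selfAdjoint (F →L[ℂ] F)) (r : ℝ) : F ≃ₗᵢ[ℂ] F :=
  Unitary.linearIsometryEquiv (fibUnitary M r)

theorem continuous_fibExp (M : selfAdjoint (F →L[ℂ] F)) :
    Continuous fun z : ℝ × F => fibExp M z.1 z.2 :=
  ((continuous_fibUnitary M).comp continuous_fst).clm_apply continuous_snd

theorem continuous_fibExp_symm (M : selfAdjoint (F →L[ℂ] F)) :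
    Continuous fun z : ℝ × F => (fibExp M z.1).symm z.2 :=
  ((continuous_fibUnitary M).star.comp continuous_fst).clm_apply continuous_snd

theorem aestronglyMeasurable_fibExp {X : Type*} [MeasurableSpace X] (μ : Measure X)
    (M : selfAdjoint (F →L[ℂ] F)) {g : X → ℝ} (hg : Measurable g) {f : X → F}
    (hf : AEStronglyMeasurable f μ) :
    AEStronglyMeasurable (fun s => fibExp M (g s) (f s)) μ :=
  Continuous.comp_aestronglyMeasurable₂ (g := fun r v => fibExp M (r) (v))
    (continuous_fibExp M) hg.aestronglyMeasurable hf

theorem norm_fibExp (M : selfAdjoint (F →L[ℂ] F)) (r : ℝ) (v : F) :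
    ‖fibExp M (r) (v)‖ = ‖v‖ :=
  LinearIsometryEquiv.norm_map (fibExp M r) v

theorem memLp_fibExp {n : ℕ} (M : selfAdjoint (F →L[ℂ] F)) {g : Pos n → ℝ}
    (hg : Measurable g) (f : Lp F 2 (volume : Measure (Pos n))) :
    MemLp (fun s => fibExp M (g s) (f s)) 2 (volume : Measure (Pos n)) :=
  (Lp.memLp f).of_le (aestronglyMeasurable_fibExp volume M hg (Lp.memLp f).1)
    (ae_of_all _ fun s => (norm_fibExp M (g s) (f s)).le)

theorem aestronglyMeasurable_fibExp_symm {X : Type*} [MeasurableSpace X] (μ : Measure X)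
    (M : selfAdjoint (F →L[ℂ] F)) {g : X → ℝ} (hg : Measurable g) {f : X → F}
    (hf : AEStronglyMeasurable f μ) :
    AEStronglyMeasurable (fun s => (fibExp M (g s)).symm (f s)) μ :=
  Continuous.comp_aestronglyMeasurable₂ (g := fun r v => (fibExp M (r)).symm (v))
    (continuous_fibExp_symm M) hg.aestronglyMeasurable hf

theorem norm_fibExp_symm (M : selfAdjoint (F →L[ℂ] F)) (r : ℝ) (v : F) :
    ‖(fibExp M (r)).symm (v)‖ = ‖v‖ :=
  LinearIsometryEquiv.norm_map (fibExp M r).symm v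

theorem memLp_fibExp_symm {n : ℕ} (M : selfAdjoint (F →L[ℂ] F)) {g : Pos n → ℝ}
    (hg : Measurable g) (f : Lp F 2 (volume : Measure (Pos n))) :
    MemLp (fun s => (fibExp M (g s)).symm (f s)) 2 (volume : Measure (Pos n)) :=
  (Lp.memLp f).of_le (aestronglyMeasurable_fibExp_symm volume M hg (Lp.memLp f).1)
    (ae_of_all _ fun s => (norm_fibExp_symm M (g s) (f s)).le)

/-- The unitary operator `exp (i g(X) ⊗ M)` on `L²(ℝⁿ; F)`, for a real Borel function `g` of the
coordinate operator and a self-adjoint `M` on the fibre. -/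
def expMul {n : ℕ} (M : selfAdjoint (F →L[ℂ] F)) (g : Pos n → ℝ) (hg : Measurable g) :
    Lp F 2 (volume : Measure (Pos n)) ≃ₗᵢ[ℂ] Lp F 2 (volume : Measure (Pos n)) where
  toFun f := (memLp_fibExp M hg f).toLp _
  invFun f := (memLp_fibExp_symm M hg f).toLp _
  map_add' f f' := by
    ext1
    filter_upwards [(memLp_fibExp M hg (f + f')).coeFn_toLp, (memLp_fibExp M hg f).coeFn_toLp,
      (memLp_fibExp M hg f').coeFn_toLp, Lp.coeFn_add f f',
      Lp.coeFn_add ((memLp_fibExp M hg f).toLp _) ((memLp_fibExp M hg f').toLp _)]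
      with s h1 h2 h3 h4 h5
    simp only [h1, h2, h3, h4, h5, Pi.add_apply, map_add]
  map_smul' c f := by
    ext1
    filter_upwards [(memLp_fibExp M hg (c • f)).coeFn_toLp, (memLp_fibExp M hg f).coeFn_toLp,
      Lp.coeFn_smul c f, Lp.coeFn_smul c ((memLp_fibExp M hg f).toLp _)]
      with s h1 h2 h4 h5
    simp only [h1, h2, h4, h5, Pi.smul_apply, map_smul, RingHom.id_apply]
  left_inv f := by
    ext1
    filter_upwards [(memLp_fibExp_symm M hg ((memLp_fibExp M hg f).toLp _)).coeFn_toLp,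
      (memLp_fibExp M hg f).coeFn_toLp] with s h1 h2
    simp only [h1, h2, LinearIsometryEquiv.symm_apply_apply]
  right_inv f := by
    ext1
    filter_upwards [(memLp_fibExp M hg ((memLp_fibExp_symm M hg f).toLp _)).coeFn_toLp,
      (memLp_fibExp_symm M hg f).coeFn_toLp] with s h1 h2
    simp only [h1, h2, LinearIsometryEquiv.apply_symm_apply]
  norm_map' f := by
    rw [Lp.norm_def, Lp.norm_def]
    congr 1
    apply eLpNorm_congr_norm_ae
    filter_upwards [(memLp_fibExp M hg f).coeFn_toLp] with s h1
    exact (congrArg norm h1).trans (LinearIsometryEquiv.norm_map _ _)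

end Exp

theorem measurable_pairing {n : ℕ} {Z : Pos n → Pos n} (hZ : Measurable Z) (p : Pos n) :
    Measurable fun s => pairing p (Z s) := by
  have h : Continuous fun x : Pos n => pairing p x := by
    unfold pairing
    fun_prop
  exact h.measurable.comp hZ

/-- A Hermitian matrix as a self-adjoint operator on `ℂᵐ`. -/
def hermitianOp {m : ℕ} (N : Matrix (Fin m) (Fin m) ℂ) (hN : N.IsHermitian) :
    selfAdjoint (Fib m →L[ℂ] Fib m) :=
  ⟨Matrix.toEuclideanCLM (𝕜 := ℂ) N, by
    have h : star N = N := hN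
    rw [selfAdjoint.mem_iff, ← map_star, h]⟩

/-- The abelian unitary group `U(p) = exp (i p_k Z(X)^k)` on `L²(ℝⁿ; F)`; for `F = ℂᵐ` this is
`U(p) ⊗ 1`. -/
def abelianU (F : Type*) [NormedAddCommGroup F] [InnerProductSpace ℂ F] [CompleteSpace F]
    {n : ℕ} (Z : Pos n → Pos n) (hZ : Measurable Z) (p : Pos n) :
    Lp F 2 (volume : Measure (Pos n)) ≃ₗᵢ[ℂ] Lp F 2 (volume : Measure (Pos n)) :=
  expMul 1 (fun s => pairing p (Z s)) (measurable_pairing hZ p)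

/-- The non-abelian unitary group `U^τ(p) = exp (i p_k Z(X)^k ⊗ N)`, `N = Y_α τ^α`. -/
def nonabelianU {n m : ℕ} (Z : Pos n → Pos n) (hZ : Measurable Z)
    (N : Matrix (Fin m) (Fin m) ℂ) (hN : N.IsHermitian) (p : Pos n) :
    HilT n m ≃ₗᵢ[ℂ] HilT n m :=
  expMul (hermitianOp N hN) (fun s => pairing p (Z s)) (measurable_pairing hZ p)

/-- The maximal domain of multiplication by a matrix-valued function `T`. -/
def matrixMulDomain {n m : ℕ} (T : Pos n → Matrix (Fin m) (Fin m) ℂ) :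
    Submodule ℂ (HilT n m) where
  carrier := {f | MemLp (fun s => Matrix.toEuclideanCLM (𝕜 := ℂ) (T s) (f s)) 2
    (volume : Measure (Pos n))}
  add_mem' := by
    intro f g hf hg
    refine (hf.add hg).ae_eq ?_
    filter_upwards [Lp.coeFn_add f g] with s hs
    simp only [hs, Pi.add_apply, map_add]
  zero_mem' := by
    refine (MemLp.zero' (p := 2) (μ := (volume : Measure (Pos n))) (ε := Fib m)).ae_eq ?_
    filter_upwards [Lp.coeFn_zero (Fib m) 2 (volume : Measure (Pos n))] with s hs
    simp only [hs, Pi.zero_apply, map_zero]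
  smul_mem' := by
    intro c f hf
    refine (hf.const_smul c).ae_eq ?_
    filter_upwards [Lp.coeFn_smul c f] with s hs
    simp only [hs, Pi.smul_apply, map_smul]

theorem memLp_of_mem_matrixMulDomain {n m : ℕ} {T : Pos n → Matrix (Fin m) (Fin m) ℂ}
    {f : HilT n m} (hf : f ∈ matrixMulDomain T) :
    MemLp (fun s => Matrix.toEuclideanCLM (𝕜 := ℂ) (T s) (f s)) 2
      (volume : Measure (Pos n)) := hf

/-- The (possibly unbounded) operator of multiplication by a matrix-valued function `T`, on its
maximal domain. -/
def matrixMul {n m : ℕ} (T : Pos n → Matrix (Fin m) (Fin m) ℂ) :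
    HilT n m →ₗ.[ℂ] HilT n m where
  domain := matrixMulDomain T
  toFun :=
    { toFun := fun f => (memLp_of_mem_matrixMulDomain f.2).toLp _
      map_add' := by
        intro f g
        ext1
        filter_upwards [(memLp_of_mem_matrixMulDomain (f + g).2).coeFn_toLp,
          (memLp_of_mem_matrixMulDomain f.2).coeFn_toLp,
          (memLp_of_mem_matrixMulDomain g.2).coeFn_toLp, Lp.coeFn_add f.1 g.1,
          Lp.coeFn_add ((memLp_of_mem_matrixMulDomain f.2).toLp _)
            ((memLp_of_mem_matrixMulDomain g.2).toLp _)] with s h1 h2 h3 h4 h5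
        rw [h1, h5, Pi.add_apply, h2, h3, Submodule.coe_add, h4, Pi.add_apply, map_add]
      map_smul' := by
        intro c f
        ext1
        filter_upwards [(memLp_of_mem_matrixMulDomain (c • f).2).coeFn_toLp,
          (memLp_of_mem_matrixMulDomain f.2).coeFn_toLp, Lp.coeFn_smul c f.1,
          Lp.coeFn_smul c ((memLp_of_mem_matrixMulDomain f.2).toLp _)] with s h1 h2 h4 h5
        rw [h1, RingHom.id_apply, h5, Pi.smul_apply, h2, Submodule.coe_smul, h4, Pi.smul_apply,
          map_smul] }

/-! ### Ampliation and adjoint action -/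

/-- The `a`-th component map `L²(ℝⁿ) ⊗ ℂᵐ → L²(ℝⁿ)`. -/
def component {n m : ℕ} (a : Fin m) : HilT n m →L[ℂ] Hil n :=
  (EuclideanSpace.proj a : Fib m →L[ℂ] ℂ).compLpL 2 volume

/-- The map `φ ↦ φ ⊗ e_a`. -/
def tensorBasis {n m : ℕ} (a : Fin m) : Hil n →L[ℂ] HilT n m :=
  (ContinuousLinearMap.toSpanSingleton ℂ (EuclideanSpace.single a (1 : ℂ) : Fib m)).compLpL
    2 volume

/-- The subspace `D ⊗ ℂᵐ` of `L²(ℝⁿ) ⊗ ℂᵐ`. -/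
def tensorDomain {n : ℕ} (m : ℕ) (D : Submodule ℂ (Hil n)) : Submodule ℂ (HilT n m) :=
  ⨅ a : Fin m, D.comap (component a).toLinearMap

theorem component_mem {n m : ℕ} {D : Submodule ℂ (Hil n)} {Φ : HilT n m}
    (h : Φ ∈ tensorDomain m D) (a : Fin m) : component a Φ ∈ D :=
  (Submodule.mem_iInf _).1 h a

/-- The operator `A ⊗ 1` with domain `D(A) ⊗ ℂᵐ`. -/
def ampliation {n : ℕ} (m : ℕ) (A : Hil n →ₗ.[ℂ] Hil n) : HilT n m →ₗ.[ℂ] HilT n m where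
  domain := tensorDomain m A.domain
  toFun :=
    { toFun := fun Φ => ∑ a : Fin m, tensorBasis a (A ⟨component a Φ.1, component_mem Φ.2 a⟩)
      map_add' := by
        intro Φ Ψ
        rw [← Finset.sum_add_distrib]
        refine Finset.sum_congr rfl fun a _ => ?_
        rw [← map_add, ← LinearPMap.map_add]
        exact congrArg (fun z => tensorBasis a (A z)) (Subtype.ext (map_add (component a) Φ.1 Ψ.1))
      map_smul' := by
        intro c Φ
        rw [RingHom.id_apply, Finset.smul_sum]
        refine Finset.sum_congr rfl fun a _ => ?_
        rw [← map_smul, ← LinearPMap.map_smul]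
        exact congrArg (fun z => tensorBasis a (A z)) (Subtype.ext (map_smul (component a) c Φ.1)) }

/-- The operator `V A V⁻¹` with domain `V D(A)`. -/
def conjugate {K : Type*} [NormedAddCommGroup K] [InnerProductSpace ℂ K]
    (V : K ≃ₗᵢ[ℂ] K) (A : K →ₗ.[ℂ] K) : K →ₗ.[ℂ] K where
  domain := A.domain.comap V.symm.toLinearEquiv.toLinearMap
  toFun :=
    { toFun := fun Φ => V (A ⟨V.symm Φ.1, Φ.2⟩)
      map_add' := by
        intro Φ Ψ
        rw [← map_add, ← LinearPMap.map_add]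
        exact congrArg (fun z => V (A z)) (Subtype.ext (map_add V.symm Φ.1 Ψ.1))
      map_smul' := by
        intro c Φ
        rw [RingHom.id_apply, ← map_smul, ← LinearPMap.map_smul]
        exact congrArg (fun z => V (A z)) (Subtype.ext (map_smul V.symm c Φ.1)) }

/-- The adjoint action `α^τ_p(A) = U^τ(p) (A ⊗ 1) U^τ(p)⁻¹`. -/
def adjointAction {n m : ℕ} (Z : Pos n → Pos n) (hZ : Measurable Z)
    (N : Matrix (Fin m) (Fin m) ℂ) (hN : N.IsHermitian) (p : Pos n)
    (A : Hil n →ₗ.[ℂ] Hil n) : HilT n m →ₗ.[ℂ] HilT n m :=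
  conjugate (nonabelianU Z hZ N hN p) (ampliation m A)

/-! ### Non-abelian warped convolutions -/

/-- `v` is the value of the oscillatory integral
`(2π)⁻ⁿ lim_{ε → 0} ∬ dx dy χ(εx, εy) e^{-ixy} b(x, y)`:
for every Schwartz cut-off `χ` with `χ(0,0) = 1` the regularized (Bochner) integrals converge
absolutely and tend to `v` in norm as `ε ↓ 0`. -/
def HasOscillatoryIntegral {n : ℕ} {K : Type*} [NormedAddCommGroup K] [NormedSpace ℂ K]
    (b : Pos n → Pos n → K) (v : K) : Prop :=
  ∀ χ : 𝓢(Pos n × Pos n, ℂ), χ 0 = 1 →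
    (∀ ε : ℝ, 0 < ε → Integrable (fun z : Pos n × Pos n =>
      (χ (ε • z) * cexp (-I * (pairing z.1 z.2 : ℝ))) • b z.1 z.2)) ∧
    Tendsto (fun ε : ℝ => (((2 * Real.pi : ℝ) : ℂ) ^ n)⁻¹ • ∫ z : Pos n × Pos n,
      (χ (ε • z) * cexp (-I * (pairing z.1 z.2 : ℝ))) • b z.1 z.2)
      (𝓝[>] (0 : ℝ)) (𝓝 v)

/-- `Φ` lies in the domain of `A^{Θ_τ} = ∫ dE(x) α^τ_{Θx}(A)` and `A^{Θ_τ} Φ = Ψ`. -/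
def IsLeftWarped {n m : ℕ} (Z : Pos n → Pos n) (hZ : Measurable Z)
    (N : Matrix (Fin m) (Fin m) ℂ) (hN : N.IsHermitian) (Θ : Matrix (Fin n) (Fin n) ℝ)
    (A : Hil n →ₗ.[ℂ] Hil n) (Φ Ψ : HilT n m) : Prop :=
  ∃ h : ∀ x : Pos n, Φ ∈ (adjointAction Z hZ N hN (Θ.toEuclideanLin x) A).domain,
    HasOscillatoryIntegral
      (fun x y => abelianU (Fib m) Z hZ y
        (adjointAction Z hZ N hN (Θ.toEuclideanLin x) A ⟨Φ, h x⟩)) Ψ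

/-- `Φ` lies in the domain of `_{Θ_τ}A = ∫ α^τ_{Θx}(A) dE(x)` and `_{Θ_τ}A Φ = Ψ`. -/
def IsRightWarped {n m : ℕ} (Z : Pos n → Pos n) (hZ : Measurable Z)
    (N : Matrix (Fin m) (Fin m) ℂ) (hN : N.IsHermitian) (Θ : Matrix (Fin n) (Fin n) ℝ)
    (A : Hil n →ₗ.[ℂ] Hil n) (Φ Ψ : HilT n m) : Prop :=
  ∃ h : ∀ x y : Pos n, abelianU (Fib m) Z hZ y Φ ∈
      (adjointAction Z hZ N hN (Θ.toEuclideanLin x) A).domain,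
    HasOscillatoryIntegral
      (fun x y => adjointAction Z hZ N hN (Θ.toEuclideanLin x) A
        ⟨abelianU (Fib m) Z hZ y Φ, h x y⟩) Ψ

/-- The domain `𝓔 ⊆ 𝓢(ℝⁿ)`: all Schwartz functions `φ` such that, for every `i`,
`U(y) φ ∈ D(P_i)` for all `y`, and `y ↦ U(y) φ` is smooth as a map into `D(P_i)` with its graph
norm, i.e. `y ↦ U(y) φ` and `y ↦ P_i U(y) φ` are smooth in norm. -/
def smoothDomain {n : ℕ} (Z : Pos n → Pos n) (hZ : Measurable Z) : Submodule ℂ (Hil n) where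
  carrier := {φ | (∃ f : 𝓢(Pos n, ℂ), f.toLp 2 volume = φ) ∧
    ContDiff ℝ ∞ (fun y => abelianU ℂ Z hZ y φ) ∧
    ∀ i : Fin n, ∃ h : ∀ y : Pos n, abelianU ℂ Z hZ y φ ∈ (momentum i).domain,
      ContDiff ℝ ∞ (fun y => momentum i ⟨abelianU ℂ Z hZ y φ, h y⟩)}
  add_mem' := by
    rintro φ ψ ⟨⟨f, hf⟩, h1, h2⟩ ⟨⟨g, hg⟩, h3, h4⟩
    refine ⟨⟨f + g, ?_⟩, ?_, fun i => ?_⟩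
    · rw [← hf, ← hg]
      exact map_add (SchwartzMap.toLpCLM ℂ ℂ 2 (volume : Measure (Pos n))) f g
    · simpa only [map_add] using h1.add h3
    · obtain ⟨d1, c1⟩ := h2 i
      obtain ⟨d2, c2⟩ := h4 i
      refine ⟨fun y => by simpa only [map_add] using add_mem (d1 y) (d2 y), ?_⟩
      convert c1.add c2 using 2 with y
      rw [← LinearPMap.map_add]
      congr 1
      exact Subtype.ext (map_add _ _ _)
  zero_mem' := by
    refine ⟨⟨0, map_zero (SchwartzMap.toLpCLM ℂ ℂ 2 (volume : Measure (Pos n)))⟩, ?_,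
      fun i => ⟨fun y => by simp, ?_⟩⟩
    · simpa only [map_zero] using contDiff_const
    · convert contDiff_const (c := (0 : Hil n)) using 2 with y
      refine (congrArg (momentum i) (Subtype.ext ?_)).trans (LinearPMap.map_zero (momentum i))
      exact map_zero (abelianU ℂ Z hZ y)
  smul_mem' := by
    rintro c φ ⟨⟨f, hf⟩, h1, h2⟩
    refine ⟨⟨c • f, ?_⟩, ?_, fun i => ?_⟩
    · rw [← hf]
      exact map_smul (SchwartzMap.toLpCLM ℂ ℂ 2 (volume : Measure (Pos n))) c f
    · simpa only [map_smul] using h1.const_smul c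
    · obtain ⟨d1, c1⟩ := h2 i
      refine ⟨fun y => by simpa only [map_smul] using Submodule.smul_mem _ c (d1 y), ?_⟩
      convert c1.const_smul c using 2 with y
      rw [← LinearPMap.map_smul]
      congr 1
      exact Subtype.ext (map_smul _ _ _)

/-! ### Generators of `SU(m)` and the gauge field -/

/-- `τ_1, …, τ_{m²-1}` are infinitesimal generators of `SU(m)`: traceless Hermitian matrices,
linearly independent over `ℝ`. By dimension they form a basis of the traceless Hermitian matrices,
so that `[τ_α, τ_β] = i f_{αβγ} τ^γ` for suitable structure constants. -/
structure IsSUGenerators {m : ℕ} (τ : Fin (m ^ 2 - 1) → Matrix (Fin m) (Fin m) ℂ) : Prop where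
  hermitian : ∀ α, (τ α).IsHermitian
  traceless : ∀ α, (τ α).trace = 0
  linearIndependent : LinearIndependent ℝ τ

/-- The function `(Θ Z(x))_k ∂_i Z(x)^k`. -/
def gaugeFactor {n : ℕ} (Z : Pos n → Pos n) (Θ : Matrix (Fin n) (Fin n) ℝ) (i : Fin n)
    (s : Pos n) : ℝ :=
  ∑ k, (Θ.toEuclideanLin (Z s)) k *
    lineDeriv ℝ (fun t => Z t k) s (EuclideanSpace.single i (1 : ℝ))

/-- The gauge field `A_{i,α}`, defined by `-q A_{i,α} = (Θ Z)_k ∂_i Z^k ⊗ Y_α`. -/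
def gaugeField {n m : ℕ} (q : ℝ) (Z : Pos n → Pos n) (Θ : Matrix (Fin n) (Fin n) ℝ)
    (Y : Fin (m ^ 2 - 1) → Matrix (Fin m) (Fin m) ℂ) (i : Fin n) (α : Fin (m ^ 2 - 1))
    (s : Pos n) : Matrix (Fin m) (Fin m) ℂ :=
  ((-(gaugeFactor Z Θ i s) / q : ℝ) : ℂ) • Y α

/-- The operator `P_i - q A_{i,α} τ^α` on `L²(ℝⁿ) ⊗ ℂᵐ`. -/
def minimalMomentum {n m : ℕ} (q : ℝ) (Z : Pos n → Pos n) (Θ : Matrix (Fin n) (Fin n) ℝ)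
    (Y τ : Fin (m ^ 2 - 1) → Matrix (Fin m) (Fin m) ℂ) (i : Fin n) :
    HilT n m →ₗ.[ℂ] HilT n m :=
  ampliation m (momentum i) -
    (q : ℂ) • matrixMul (fun s => ∑ α, gaugeField q Z Θ Y i α s * τ α)

end NAWarped

end

noncomputable section

namespace NAWarped

/-! ### Exponentials on eigenvectors -/

/-! Diagonalize the Hermitian matrix `N` = Y_α τ^α, with orthonormal eigenvectors v_j and real
eigenvalues c_j. On φ ⊗ v_j the group U^τ(p) is U(c_j p) ⊗ 1, so the non-abelian deformation splits
into scalar ones, one for each eigenvalue (`nonabelianU_tensorVec`, `adjointAction_tensorVec`).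

For φ in 𝓔 one has P_i U(y)φ = U(y)(a - ∑ y_k b_k) with a = P_i φ and b_k = (∂_i Z^k) φ
(`exists_momentum_abelianU`). Hence on an eigenvector with eigenvalue c the left integrand is U(y)(a
+ c ∑ (Θx)_k b_k), and the right one is the same minus ∑ y_k U(y) b_k. Both are affine in (x, y),
with bounded smooth orbits of U as coefficients.

Three rules evaluate such oscillatory integrals: V(y) gives V(0) (`hasOscillatoryIntegral_snd`), x_l
V(y) gives -i ∂_l V(0) (`hasOscillatoryIntegral_fst_smul`), and y_l V(y) gives 0
(`hasOscillatoryIntegral_snd_smul`). For V = U(·) b_k the second value is Z_l b_k, so the result is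
a + c ∑ Θ_kl Z_l (∂_i Z^k) φ, which is the momentum plus the gauge term since `N` acts on v as c.
The third rule is why the left and right deformations coincide.

Density holds because 𝓔 contains the smooth functions with compact support in the open set where Z
is C¹: Z is bounded on such a support, so U(y) acts smoothly there. -/

theorem exp_apply_of_apply_eq_smul {F : Type*} [NormedAddCommGroup F] [NormedSpace ℂ F]
    [CompleteSpace F] {T : F →L[ℂ] F} {v : F} {c : ℂ} (h : T v = c • v) :
    NormedSpace.exp T v = cexp c • v := by
  have hpow : ∀ k : ℕ, (T ^ k) v = c ^ k • v := by
    intro k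
    induction k with
    | zero => simp
    | succ k ih =>
      rw [pow_succ, mul_apply_eq_comp, h, map_smul, ih, smul_smul, pow_succ, mul_comm]
  have h1 := (NormedSpace.exp_series_hasSum_exp' (𝕂 := ℂ) T).mapL
    (ContinuousLinearMap.apply ℂ F v)
  have h2 := (NormedSpace.exp_series_hasSum_exp' (𝕂 := ℂ) c).mapL
    (ContinuousLinearMap.toSpanSingleton ℂ v)
  rw [← Complex.exp_eq_exp_ℂ] at h2
  refine h1.unique ?_
  convert h2 using 2 with k
  · simp [hpow, smul_smul]
  · simp

section Exp

variable {F : Type*} [NormedAddCommGroup F] [InnerProductSpace ℂ F] [CompleteSpace F]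

theorem fibExp_apply_of_apply_eq_smul {M : selfAdjoint (F →L[ℂ] F)} {v : F} {c : ℝ}
    (h : (M : F →L[ℂ] F) v = (c : ℂ) • v) (r : ℝ) :
    fibExp M r v = cexp (I * (r * c : ℝ)) • v := by
  have : fibExp M r v = NormedSpace.exp (I • ((r : ℂ) • (M : F →L[ℂ] F))) v := rfl
  rw [this]
  apply exp_apply_of_apply_eq_smul
  simp [h, mul_smul]

theorem fibExp_one_apply (r : ℝ) (v : F) :
    fibExp (1 : selfAdjoint (F →L[ℂ] F)) r v = cexp (I * r) • v := by
  rw [fibExp_apply_of_apply_eq_smul (c := 1) (by simp), mul_one]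

theorem coeFn_expMul {n : ℕ} (M : selfAdjoint (F →L[ℂ] F)) (g : Pos n → ℝ) (hg : Measurable g)
    (f : Lp F 2 (volume : Measure (Pos n))) :
    expMul M g hg f =ᵐ[volume] fun s => fibExp M (g s) (f s) :=
  (memLp_fibExp M hg f).coeFn_toLp

/-! ### The abelian unitaries as phase functions and their group law. -/

variable {n : ℕ} {Z : Pos n → Pos n} (hZ : Measurable Z)

theorem coeFn_abelianU (p : Pos n) (f : Lp F 2 (volume : Measure (Pos n))) :
    abelianU F Z hZ p f =ᵐ[volume] fun s => cexp (I * (pairing p (Z s) : ℝ)) • f s := by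
  filter_upwards [coeFn_expMul (1 : selfAdjoint (F →L[ℂ] F)) (fun s => pairing p (Z s))
    (measurable_pairing hZ p) f] with s hs
  exact hs.trans (fibExp_one_apply _ _)

theorem pairing_add_left (p q x : Pos n) : pairing (p + q) x = pairing p x + pairing q x := by
  simp [pairing, add_mul, Finset.sum_add_distrib]

theorem pairing_smul_left (c : ℝ) (p x : Pos n) : pairing (c • p) x = c * pairing p x := by
  simp [pairing, Finset.mul_sum, mul_assoc]

theorem pairing_eq_inner (p x : Pos n) : pairing p x = inner ℝ p x := by
  simp [pairing, PiLp.inner_apply, mul_comm]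

theorem pairing_single_left (k : Fin n) (x : Pos n) :
    pairing (EuclideanSpace.single k (1 : ℝ)) x = x k := by
  simp [pairing]

theorem abs_pairing_le (p x : Pos n) : |pairing p x| ≤ ‖p‖ * ‖x‖ := by
  rw [pairing_eq_inner]
  exact abs_real_inner_le_norm p x

theorem abelianU_add (p q : Pos n) (f : Lp F 2 (volume : Measure (Pos n))) :
    abelianU F Z hZ (p + q) f = abelianU F Z hZ p (abelianU F Z hZ q f) := by
  ext1
  filter_upwards [coeFn_abelianU hZ (p + q) f, coeFn_abelianU hZ p (abelianU F Z hZ q f),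
    coeFn_abelianU hZ q f] with s h1 h2 h3
  rw [h1, h2, h3, smul_smul, ← Complex.exp_add, pairing_add_left]
  congr 2
  push_cast
  ring

theorem abelianU_zero (f : Lp F 2 (volume : Measure (Pos n))) :
    abelianU F Z hZ 0 f = f := by
  ext1
  filter_upwards [coeFn_abelianU hZ 0 f] with s h1
  rw [h1]
  simp [pairing]

theorem abelianU_abelianU_neg (p : Pos n) (f : Lp F 2 (volume : Measure (Pos n))) :
    abelianU F Z hZ p (abelianU F Z hZ (-p) f) = f := by
  rw [← abelianU_add, add_neg_cancel, abelianU_zero]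

end Exp

/-! ### Elementary tensors -/

/-- The map `φ ↦ φ ⊗ v`. -/
def tensorVec {n m : ℕ} (v : Fib m) : Hil n →L[ℂ] HilT n m :=
  (ContinuousLinearMap.toSpanSingleton ℂ v).compLpL 2 volume

theorem tensorBasis_eq {n m : ℕ} (a : Fin m) :
    (tensorBasis a : Hil n →L[ℂ] HilT n m) = tensorVec (EuclideanSpace.single a (1 : ℂ)) := rfl

section Tensor

variable {n m : ℕ}

theorem coeFn_tensorVec (v : Fib m) (f : Hil n) :
    tensorVec v f =ᵐ[volume] fun s => f s • v := by
  filter_upwards [ContinuousLinearMap.coeFn_compLpL (p := 2) (μ := (volume : Measure (Pos n)))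
    (ContinuousLinearMap.toSpanSingleton ℂ v) f] with s hs
  exact hs

theorem coeFn_component (a : Fin m) (Φ : HilT n m) :
    component a Φ =ᵐ[volume] fun s => Φ s a := by
  filter_upwards [ContinuousLinearMap.coeFn_compLpL (p := 2) (μ := (volume : Measure (Pos n)))
    (EuclideanSpace.proj a : Fib m →L[ℂ] ℂ) Φ] with s hs
  exact hs

theorem component_tensorVec (a : Fin m) (v : Fib m) (f : Hil n) :
    component a (tensorVec v f) = v a • f := by
  ext1
  filter_upwards [coeFn_component a (tensorVec v f), coeFn_tensorVec v f,
    Lp.coeFn_smul (v a) f] with s h1 h2 h3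
  rw [h1, h2, h3]
  simp [mul_comm]

theorem tensorVec_sum_smul {ι : Type*} (t : Finset ι) (c : ι → ℂ) (v : ι → Fib m) (f : Hil n) :
    tensorVec (∑ j ∈ t, c j • v j) f = ∑ j ∈ t, c j • tensorVec (v j) f := by
  classical
  induction t using Finset.induction_on with
  | empty =>
    ext1
    filter_upwards [coeFn_tensorVec (0 : Fib m) f,
      Lp.coeFn_zero (Fib m) 2 (volume : Measure (Pos n))] with s h1 h2
    rw [Finset.sum_empty, Finset.sum_empty, h1, h2]
    simp
  | insert a t ha ih =>
    rw [Finset.sum_insert ha, Finset.sum_insert ha, ← ih]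
    ext1
    filter_upwards [coeFn_tensorVec (c a • v a + ∑ j ∈ t, c j • v j) f,
      Lp.coeFn_add (c a • tensorVec (v a) f) (tensorVec (∑ j ∈ t, c j • v j) f),
      Lp.coeFn_smul (c a) (tensorVec (v a) f), coeFn_tensorVec (v a) f,
      coeFn_tensorVec (∑ j ∈ t, c j • v j) f] with s h1 h2 h3 h4 h5
    rw [h1, h2, Pi.add_apply, h3, Pi.smul_apply, h4, h5, smul_add, smul_comm]

theorem sum_single_smul (v : Fib m) :
    ∑ a, v a • (EuclideanSpace.single a (1 : ℂ) : Fib m) = v := by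
  ext b
  simp [Pi.single_apply]

theorem sum_tensorBasis_component (Φ : HilT n m) : ∑ a, tensorBasis a (component a Φ) = Φ := by
  ext1
  have h : ∀ᵐ s ∂(volume : Measure (Pos n)), ∀ a : Fin m,
      tensorBasis a (component a Φ) s = Φ s a • (EuclideanSpace.single a (1 : ℂ) : Fib m) := by
    rw [ae_all_iff]
    intro a
    filter_upwards [coeFn_tensorVec (EuclideanSpace.single a (1 : ℂ)) (component a Φ),
      coeFn_component a Φ] with s h1 h2
    rw [tensorBasis_eq, h1, h2]
  filter_upwards [h, Lp.coeFn_finsetSum Finset.univ fun a => tensorBasis a (component a Φ)]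
    with s h1 h2
  rw [h2, Finset.sum_apply]
  simp only [h1]
  exact sum_single_smul (Φ s)

theorem tensorVec_mem_tensorDomain {D : Submodule ℂ (Hil n)} {f : Hil n} (hf : f ∈ D)
    (v : Fib m) : tensorVec v f ∈ tensorDomain m D := by
  refine (Submodule.mem_iInf _).2 fun a => ?_
  change component a (tensorVec v f) ∈ D
  rw [component_tensorVec]
  exact D.smul_mem _ hf

/-- Expansion of a vector of `D ⊗ ℂᵐ` along an orthonormal basis of `ℂᵐ`. -/
theorem exists_eq_sum_tensorVec {D : Submodule ℂ (Hil n)} {Φ : HilT n m}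
    (h : Φ ∈ tensorDomain m D) (b : OrthonormalBasis (Fin m) ℂ (Fib m)) :
    ∃ φ : Fin m → Hil n, (∀ j, φ j ∈ D) ∧ Φ = ∑ j, tensorVec (b j) (φ j) := by
  -- Since e_a = ∑_j ⟨b_j, e_a⟩ b_j, regrouping the standard components of Φ along `b` gives these
  -- coefficients; being linear combinations of the components, they stay in `D`.
  refine ⟨fun j => ∑ a, inner ℂ (b j) (EuclideanSpace.single a (1 : ℂ) : Fib m) • component a Φ,
    fun j => D.sum_mem fun a _ => D.smul_mem _ (component_mem h a), ?_⟩
  conv_lhs => rw [← sum_tensorBasis_component Φ]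
  simp only [map_sum, map_smul]
  rw [Finset.sum_comm]
  refine Finset.sum_congr rfl fun a _ => ?_
  rw [tensorBasis_eq, ← tensorVec_sum_smul]
  congr 1
  rw [OrthonormalBasis.sum_repr' b]

theorem abelianU_tensorVec {Z : Pos n → Pos n} (hZ : Measurable Z) (p : Pos n) (v : Fib m)
    (f : Hil n) :
    abelianU (Fib m) Z hZ p (tensorVec v f) = tensorVec v (abelianU ℂ Z hZ p f) := by
  ext1
  filter_upwards [coeFn_abelianU hZ p (tensorVec v f), coeFn_tensorVec v f,
    coeFn_tensorVec v (abelianU ℂ Z hZ p f), coeFn_abelianU hZ p f] with s h1 h2 h3 h4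
  rw [h1, h2, h3, h4, smul_smul, smul_eq_mul]

/-- On an eigenvector the fibre exponential is a scalar phase, and c(p·Z) = (c p)·Z makes that phase
an abelian unitary with rescaled parameter. -/
theorem nonabelianU_tensorVec {Z : Pos n → Pos n} (hZ : Measurable Z)
    {N : Matrix (Fin m) (Fin m) ℂ} (hN : N.IsHermitian) {v : Fib m} {c : ℝ}
    (hv : Matrix.toEuclideanCLM (𝕜 := ℂ) N v = (c : ℂ) • v) (p : Pos n) (f : Hil n) :
    nonabelianU Z hZ N hN p (tensorVec v f) = tensorVec v (abelianU ℂ Z hZ (c • p) f) := by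
  ext1
  filter_upwards [coeFn_expMul (hermitianOp N hN) (fun s => pairing p (Z s))
      (measurable_pairing hZ p) (tensorVec v f), coeFn_tensorVec v f,
    coeFn_tensorVec v (abelianU ℂ Z hZ (c • p) f), coeFn_abelianU hZ (c • p) f] with s h1 h2 h3 h4
  refine h1.trans ?_
  rw [h2, h3, h4, map_smul, fibExp_apply_of_apply_eq_smul (c := c) hv, pairing_smul_left,
    smul_smul, smul_eq_mul, mul_comm, mul_comm c]

theorem nonabelianU_symm_tensorVec {Z : Pos n → Pos n} (hZ : Measurable Z)
    {N : Matrix (Fin m) (Fin m) ℂ} (hN : N.IsHermitian) {v : Fib m} {c : ℝ}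
    (hv : Matrix.toEuclideanCLM (𝕜 := ℂ) N v = (c : ℂ) • v) (p : Pos n) (f : Hil n) :
    (nonabelianU Z hZ N hN p).symm (tensorVec v f) =
      tensorVec v (abelianU ℂ Z hZ (-(c • p)) f) := by
  rw [LinearIsometryEquiv.symm_apply_eq, nonabelianU_tensorVec hZ hN hv, abelianU_abelianU_neg]

theorem ampliation_tensorVec (A : Hil n →ₗ.[ℂ] Hil n) (v : Fib m) (f : A.domain)
    (h : tensorVec v f.1 ∈ (ampliation m A).domain) :
    ampliation m A ⟨tensorVec v f.1, h⟩ = tensorVec v (A f) := by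
  have key : ∀ a : Fin m, A ⟨component a (tensorVec v f.1), component_mem h a⟩ = v a • A f := by
    intro a
    rw [← LinearPMap.map_smul]
    exact congrArg A (Subtype.ext (component_tensorVec a v f.1))
  change ∑ a, tensorBasis a (A ⟨component a (tensorVec v f.1), component_mem h a⟩) = _
  simp only [key, map_smul, tensorBasis_eq]
  rw [← tensorVec_sum_smul, sum_single_smul]

/-- The adjoint action on elementary tensors along an eigenvector of the fibre matrix. -/
theorem adjointAction_tensorVec {Z : Pos n → Pos n} (hZ : Measurable Z)
    {N : Matrix (Fin m) (Fin m) ℂ} (hN : N.IsHermitian) {v : Fib m} {c : ℝ}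
    (hv : Matrix.toEuclideanCLM (𝕜 := ℂ) N v = (c : ℂ) • v) (p : Pos n)
    (A : Hil n →ₗ.[ℂ] Hil n) (f : Hil n) (hf : abelianU ℂ Z hZ (-(c • p)) f ∈ A.domain) :
    ∃ h : tensorVec v f ∈ (adjointAction Z hZ N hN p A).domain,
      adjointAction Z hZ N hN p A ⟨tensorVec v f, h⟩ =
        tensorVec v (abelianU ℂ Z hZ (c • p) (A ⟨_, hf⟩)) := by
  have e := nonabelianU_symm_tensorVec hZ hN hv p f
  have h : tensorVec v (abelianU ℂ Z hZ (-(c • p)) f) ∈ (ampliation m A).domain :=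
    tensorVec_mem_tensorDomain hf v
  have h' : tensorVec v f ∈ (adjointAction Z hZ N hN p A).domain := by
    change (nonabelianU Z hZ N hN p).symm (tensorVec v f) ∈ (ampliation m A).domain
    rwa [e]
  refine ⟨h', ?_⟩
  rw [← nonabelianU_tensorVec hZ hN hv, ← ampliation_tensorVec A v ⟨_, hf⟩ h]
  exact congrArg (fun z => nonabelianU Z hZ N hN p (ampliation m A z)) (Subtype.ext e)

end Tensor

/-! ### The momentum operator -/

section Momentum

variable {n : ℕ}

theorem momentumCore_domain (i : Fin n) (f : 𝓢(Pos n, ℂ)) :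
    f.toLp 2 volume ∈ (momentumCore i).domain := ⟨f, rfl⟩

theorem momentumCore_apply (i : Fin n) (f : 𝓢(Pos n, ℂ))
    (h : f.toLp 2 volume ∈ (momentumCore i).domain) :
    momentumCore i ⟨f.toLp 2 volume, h⟩ =
      I • (∂_{EuclideanSpace.single i (1 : ℝ)} f).toLp 2 volume := by
  have key : (LinearEquiv.ofInjective
        (SchwartzMap.toLpCLM ℂ ℂ 2 (volume : Measure (Pos n))).toLinearMap
        (SchwartzMap.injective_toLp 2 volume)).symm ⟨f.toLp 2 volume, h⟩ = f := by
    rw [LinearEquiv.symm_apply_eq]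
    rfl
  change I • (∂_{EuclideanSpace.single i (1 : ℝ)} ((LinearEquiv.ofInjective
        (SchwartzMap.toLpCLM ℂ ℂ 2 (volume : Measure (Pos n))).toLinearMap
        (SchwartzMap.injective_toLp 2 volume)).symm ⟨f.toLp 2 volume, h⟩)).toLp 2 volume = _
  rw [key]

/-- The sign from integration by parts is absorbed by conj(i) = -i. This symmetry makes the core
operator closable. -/
theorem inner_lineDeriv_left (i : Fin n) (f g : 𝓢(Pos n, ℂ)) :
    inner ℂ (I • (∂_{EuclideanSpace.single i (1 : ℝ)} f).toLp 2 volume) (g.toLp 2 volume) =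
      inner ℂ (f.toLp 2 volume)
        (I • (∂_{EuclideanSpace.single i (1 : ℝ)} g).toLp 2 volume) := by
  have h := SchwartzMap.integral_bilinear_lineDerivOp_right_eq_neg_left (μ := volume) f g
    ((ContinuousLinearMap.mul ℝ ℂ).comp (Complex.conjCLE : ℂ →L[ℝ] ℂ))
    (EuclideanSpace.single i (1 : ℝ))
  rw [inner_smul_left, inner_smul_right, SchwartzMap.inner_toL2_toL2_eq _ _ volume,
    SchwartzMap.inner_toL2_toL2_eq _ _ volume]
  simp only [ContinuousLinearMap.coe_comp, Function.comp_apply, ContinuousLinearMap.mul_apply',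
    ContinuousLinearEquiv.coe_coe, Complex.conjCLE_apply] at h
  simp only [RCLike.inner_apply']
  rw [h]
  simp

theorem dense_momentumCore_domain (i : Fin n) :
    Dense ((momentumCore i).domain : Set (Hil n)) := by
  have h := SchwartzMap.denseRange_toLpCLM (F := ℂ) (p := 2) (by simp)
    (μ := (volume : Measure (Pos n)))
  exact h

theorem momentumCore_isFormalAdjoint (i : Fin n) :
    (momentumCore i).IsFormalAdjoint (momentumCore i) := by
  rintro ⟨_, f, rfl⟩ ⟨_, g, rfl⟩
  have hf := momentumCore_apply i f (momentumCore_domain i f)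
  have hg := momentumCore_apply i g (momentumCore_domain i g)
  change inner ℂ (momentumCore i ⟨f.toLp 2 volume, momentumCore_domain i f⟩) (g.toLp 2 volume) =
    inner ℂ (f.toLp 2 volume) (momentumCore i ⟨g.toLp 2 volume, momentumCore_domain i g⟩)
  rw [hf, hg]
  exact inner_lineDeriv_left i f g

theorem momentumCore_isClosable (i : Fin n) : (momentumCore i).IsClosable :=
  (LinearPMap.adjoint_isClosed (dense_momentumCore_domain i)).isClosable.leIsClosable
    ((momentumCore_isFormalAdjoint i).le_adjoint (dense_momentumCore_domain i))

/-- A symmetric operator is contained in its adjoint, which is closed and so contains the closure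
too. This gives `momentum` a weak-derivative description on all of its domain, where the closure
itself only offers approximating sequences. -/
theorem momentum_le_adjoint (i : Fin n) : momentum i ≤ (momentumCore i).adjoint := by
  have hc := LinearPMap.adjoint_isClosed (dense_momentumCore_domain i)
  have h := hc.isClosable.closure_mono
    ((momentumCore_isFormalAdjoint i).le_adjoint (dense_momentumCore_domain i))
  have e : (momentumCore i).adjoint.closure = (momentumCore i).adjoint := by
    apply LinearPMap.eq_of_eq_graph
    rw [← hc.isClosable.graph_closure_eq_closure_graph]
    exact IsClosed.submodule_topologicalClosure_eq hc
  rwa [e] at h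

theorem inner_momentum (i : Fin n) (φ : (momentum i).domain) (f : 𝓢(Pos n, ℂ)) :
    inner ℂ (f.toLp 2 volume) (momentum i φ) =
      inner ℂ (I • (∂_{EuclideanSpace.single i (1 : ℝ)} f).toLp 2 volume) (φ : Hil n) := by
  obtain ⟨h1, h2⟩ := momentum_le_adjoint i
  have e : momentum i φ = (momentumCore i).adjoint ⟨φ, h1 φ.2⟩ := h2 rfl
  rw [e]
  have h := (LinearPMap.adjoint_isFormalAdjoint (dense_momentumCore_domain i))
    ⟨φ, h1 φ.2⟩ ⟨f.toLp 2 volume, momentumCore_domain i f⟩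
  rw [← inner_conj_symm, h, inner_conj_symm, momentumCore_apply]

theorem exists_momentum_of_tendsto (i : Fin n) {u : ℕ → 𝓢(Pos n, ℂ)} {φ χ : Hil n}
    (h1 : Tendsto (fun k => (u k).toLp 2 volume) atTop (𝓝 φ))
    (h2 : Tendsto (fun k => (∂_{EuclideanSpace.single i (1 : ℝ)} (u k)).toLp 2 volume)
      atTop (𝓝 χ)) :
    ∃ h : φ ∈ (momentum i).domain, momentum i ⟨φ, h⟩ = I • χ := by
  have hm : (φ, I • χ) ∈ (momentumCore i).graph.topologicalClosure := by
    have ht : Tendsto (fun k => ((u k).toLp 2 (volume : Measure (Pos n)),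
        I • (∂_{EuclideanSpace.single i (1 : ℝ)} (u k)).toLp 2 (volume : Measure (Pos n))))
        atTop (𝓝 (φ, I • χ)) := h1.prodMk_nhds (h2.const_smul I)
    refine mem_closure_of_tendsto ht (Eventually.of_forall fun k => ?_)
    exact (LinearPMap.mem_graph_iff _).2 ⟨⟨_, momentumCore_domain i (u k)⟩, rfl,
      momentumCore_apply i (u k) _⟩
  rw [(momentumCore_isClosable i).graph_closure_eq_closure_graph, LinearPMap.mem_graph_iff] at hm
  obtain ⟨y, hy1, hy2⟩ := hm
  simp only at hy1 hy2
  subst hy1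
  exact ⟨y.2, hy2⟩

theorem integral_smul_momentum (i : Fin n) (φ : (momentum i).domain) {g : Pos n → ℝ}
    (hg : ContDiff ℝ ∞ g) (hc : HasCompactSupport g) :
    ∫ s, g s • momentum i φ s =
      -(I * ∫ s, lineDeriv ℝ g s (EuclideanSpace.single i (1 : ℝ)) • (φ : Hil n) s) := by
  have hc' : HasCompactSupport fun s => (g s : ℂ) := hc.comp_left (g := ((↑) : ℝ → ℂ)) rfl
  have hg' : ContDiff ℝ ∞ fun s => (g s : ℂ) := Complex.ofRealCLM.contDiff.comp hg
  have hd : ∀ s v, lineDeriv ℝ (fun s => (g s : ℂ)) s v = lineDeriv ℝ g s v := by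
    intro s v
    have h1 := (hg.differentiable (by simp) s).hasFDerivAt
    rw [(h1.hasLineDerivAt v).lineDeriv]
    exact ((Complex.ofRealCLM.hasFDerivAt.comp s h1).hasLineDerivAt v).lineDeriv
  have h := inner_momentum i φ (hc'.toSchwartzMap hg')
  rw [inner_smul_left, L2.inner_def, L2.inner_def] at h
  have e1 : ∫ s, g s • momentum i φ s = ∫ s, inner ℂ
      ((hc'.toSchwartzMap hg').toLp 2 (volume : Measure (Pos n)) s) (momentum i φ s) := by
    apply integral_congr_ae
    filter_upwards [(hc'.toSchwartzMap hg').coeFn_toLp 2 (volume : Measure (Pos n))] with s hs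
    rw [hs]
    simp [mul_comm]
  have e2 : ∫ s, lineDeriv ℝ g s (EuclideanSpace.single i (1 : ℝ)) • (φ : Hil n) s =
      ∫ s, inner ℂ ((∂_{EuclideanSpace.single i (1 : ℝ)} (hc'.toSchwartzMap hg')).toLp 2
        (volume : Measure (Pos n)) s) ((φ : Hil n) s) := by
    apply integral_congr_ae
    filter_upwards [(∂_{EuclideanSpace.single i (1 : ℝ)} (hc'.toSchwartzMap hg')).coeFn_toLp 2
      (volume : Measure (Pos n))] with s hs
    rw [hs, SchwartzMap.lineDerivOp_apply]
    change _ = inner ℂ (lineDeriv ℝ (fun s => (g s : ℂ)) s _) _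
    rw [hd]
    simp [mul_comm]
  rw [e1, h, e2]
  simp

/-- On an open set where a vector of the domain of `P_i` has a continuous derivative, `P_i` is the
classical `i ∂_i`. -/
theorem momentum_ae_eq_of_hasLineDerivAt (i : Fin n) (φ : (momentum i).domain)
    {O : Set (Pos n)} (hO : IsOpen O) {f f' : Pos n → ℂ} (hφ : (φ : Hil n) =ᵐ[volume] f)
    (hf : ∀ s ∈ O, HasLineDerivAt ℝ f (f' s) s (EuclideanSpace.single i (1 : ℝ)))
    (hf' : ContinuousOn f' O) :
    ∀ᵐ s ∂(volume : Measure (Pos n)), s ∈ O → momentum i φ s = I * f' s := by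
  have hP : LocallyIntegrable (momentum i φ) (volume : Measure (Pos n)) :=
    (Lp.memLp (momentum i φ)).locallyIntegrable (by norm_num)
  have hφi : LocallyIntegrable f (volume : Measure (Pos n)) :=
    (((memLp_congr_ae hφ).1 (Lp.memLp (φ : Hil n))).locallyIntegrable (by norm_num))
  have key : ∀ᵐ s ∂(volume : Measure (Pos n)), s ∈ O → momentum i φ s - I * f' s = 0 := by
    refine hO.ae_eq_zero_of_integral_contDiff_smul_eq_zero ?_ ?_
    · exact (hP.locallyIntegrableOn O).sub
        ((continuousOn_const.mul hf').locallyIntegrableOn hO.measurableSet)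
    · intro g hg hc hs
      have hgd : ∀ s, HasLineDerivAt ℝ g (fderiv ℝ g s (EuclideanSpace.single i (1 : ℝ))) s
          (EuclideanSpace.single i (1 : ℝ)) := fun s =>
        (hg.differentiable (by simp) s).hasFDerivAt.hasLineDerivAt _
      have hg'c : Continuous fun s => fderiv ℝ g s (EuclideanSpace.single i (1 : ℝ)) :=
        (hg.continuous_fderiv (by simp)).clm_apply continuous_const
      have hg's : HasCompactSupport fun s => fderiv ℝ g s (EuclideanSpace.single i (1 : ℝ)) :=
        hc.fderiv_apply ℝ _
      have i1 : Integrable (fun s => g s • momentum i φ s) volume :=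
        hP.integrable_smul_left_of_hasCompactSupport hg.continuous hc
      -- `f'` is controlled only on `O`; the product is nevertheless continuous everywhere, because
      -- it vanishes near every point outside `tsupport g`, and `tsupport g` lies in `O`.
      have hgf : Continuous fun s => g s • f' s := by
        rw [continuous_iff_continuousAt]
        intro s
        by_cases h : s ∈ tsupport g
        · exact hg.continuous.continuousAt.smul (hf'.continuousAt (hO.mem_nhds (hs h)))
        · have : (fun s => g s • f' s) =ᶠ[𝓝 s] fun _ => 0 := by
            filter_upwards [notMem_tsupport_iff_eventuallyEq.1 h] with t ht
            simp [ht]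
          exact continuousAt_const.congr this.symm
      have i2 : Integrable (fun s => g s • f' s) volume :=
        hgf.integrable_of_hasCompactSupport hc.smul_right
      -- The derivative of `f` is needed only on `tsupport g`, so nothing is asked of `f` outside
      -- `O`.
      have hparts := integral_bilinear_hasLineDerivAt_right_eq_neg_left_of_integrable
        (μ := (volume : Measure (Pos n))) (f := g)
        (f' := fun s => fderiv ℝ g s (EuclideanSpace.single i (1 : ℝ))) (g := f) (g' := f')
        (v := EuclideanSpace.single i (1 : ℝ)) (B := ContinuousLinearMap.lsmul ℝ ℝ)
        (hφi.integrable_smul_left_of_hasCompactSupport hg'c hg's) i2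
        (hφi.integrable_smul_left_of_hasCompactSupport hg.continuous hc)
        (fun s _ => hgd s) (fun s h => hf s (hs h))
      simp only [ContinuousLinearMap.lsmul_apply] at hparts
      have hw := integral_smul_momentum i φ hg hc
      have e : ∫ s, lineDeriv ℝ g s (EuclideanSpace.single i (1 : ℝ)) • (φ : Hil n) s =
          ∫ s, fderiv ℝ g s (EuclideanSpace.single i (1 : ℝ)) • f s := by
        apply integral_congr_ae
        filter_upwards [hφ] with s h
        rw [h, (hgd s).lineDeriv]
      have e3 : ∀ s, g s • (momentum i φ s - I * f' s) =
          g s • momentum i φ s - I * (g s • f' s) := by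
        intro s
        simp only [Complex.real_smul]
        ring
      simp only [e3]
      rw [integral_sub i1 (i2.const_mul I), integral_const_mul, hparts, hw, e]
      ring
  filter_upwards [key] with s h hs
  exact sub_eq_zero.1 (h hs)

/-! ### Mollification -/

open scoped Pointwise in
theorem exists_isCompact_support_convolution_subset {E : Type*} [NormedAddCommGroup E]
    [NormedSpace ℝ E] [CompleteSpace E] {g : Pos n → E} (hc : HasCompactSupport g) :
    ∃ K : Set (Pos n), IsCompact K ∧ Function.support g ⊆ K ∧
      ∀ φ : ContDiffBump (0 : Pos n), φ.rOut ≤ 1 →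
        Function.support (convolution (φ.normed volume) g (ContinuousLinearMap.lsmul ℝ ℝ) volume)
          ⊆ K := by
  refine ⟨Metric.closedBall 0 1 + tsupport g, (isCompact_closedBall 0 1).add hc, ?_, ?_⟩
  · intro x hx
    exact ⟨0, by simp, x, subset_tsupport g hx, by simp⟩
  · intro φ hφ
    refine (support_convolution_subset _).trans (Set.add_subset_add ?_ (subset_tsupport g))
    rw [φ.support_normed_eq]
    exact Metric.ball_subset_closedBall.trans (Metric.closedBall_subset_closedBall hφ)

/-- Uniform continuity makes the mollification uniformly ε-close to `g`, and all supports lie in one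
compact `K` as the radii are at most 1; the L² distance is then at most ε |K|^{1/2}. -/
theorem tendsto_eLpNorm_convolution_sub {E : Type*} [NormedAddCommGroup E]
    [NormedSpace ℝ E] [CompleteSpace E] {g : Pos n → E} (hg : Continuous g)
    (hc : HasCompactSupport g) {φ : ℕ → ContDiffBump (0 : Pos n)} (hφ1 : ∀ k, (φ k).rOut ≤ 1)
    (hφ : Tendsto (fun k => (φ k).rOut) atTop (𝓝 0)) :
    Tendsto (fun k => eLpNorm (convolution ((φ k).normed volume) g
      (ContinuousLinearMap.lsmul ℝ ℝ) volume - g) 2 volume) atTop (𝓝 0) := by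
  obtain ⟨K, hK, hgK, hKφ⟩ := exists_isCompact_support_convolution_subset hc
  have huc := hc.uniformContinuous_of_continuous hg
  have hV : (volume : Measure (Pos n)) K ^ (1 / (2 : ℝ≥0∞).toReal) ≠ ⊤ :=
    ENNReal.rpow_ne_top_of_nonneg (by simp) hK.measure_lt_top.ne
  have hlim : Tendsto (fun ε : ℝ => ENNReal.ofReal ε *
      (volume : Measure (Pos n)) K ^ (1 / (2 : ℝ≥0∞).toReal)) (𝓝[>] 0) (𝓝 0) := by
    have h1 : Tendsto (fun ε : ℝ => ENNReal.ofReal ε) (𝓝[>] 0) (𝓝 0) := by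
      simpa using (ENNReal.tendsto_ofReal (tendsto_id (x := 𝓝 (0 : ℝ)))).mono_left
        nhdsWithin_le_nhds
    simpa using ENNReal.Tendsto.mul_const h1 (Or.inr hV)
  rw [ENNReal.tendsto_nhds_zero]
  intro η hη
  have h2 := (hlim.eventually (ge_mem_nhds hη)).and self_mem_nhdsWithin
  obtain ⟨ε, hε, hε0⟩ := h2.exists
  obtain ⟨δ, hδ, hd⟩ := Metric.uniformContinuous_iff.1 huc ε hε0
  filter_upwards [hφ.eventually (gt_mem_nhds hδ)] with k hk
  refine le_trans ?_ hε
  refine eLpNorm_sub_le_of_dist_bdd volume (by simp) hK.measurableSet (le_of_lt hε0) ?_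
    (hKφ _ (hφ1 k)) hgK
  intro x
  refine (φ k).dist_normed_convolution_le hg.aestronglyMeasurable fun y hy => ?_
  exact (hd (lt_trans (Metric.mem_ball.1 hy) hk)).le

/-- Compactly supported `C¹` functions lie in the domain of `P_i`. -/
theorem exists_momentum_of_contDiff (i : Fin n) {g : Pos n → ℂ} (hg : ContDiff ℝ 1 g)
    (hc : HasCompactSupport g) {φ χ : Hil n} (hφ : φ =ᵐ[volume] g)
    (hχ : χ =ᵐ[volume] fun s => fderiv ℝ g s (EuclideanSpace.single i (1 : ℝ))) :
    ∃ h : φ ∈ (momentum i).domain, momentum i ⟨φ, h⟩ = I • χ := by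
  let b : ℕ → ContDiffBump (0 : Pos n) := fun k =>
    { rIn := 1 / ((k : ℝ) + 1) / 2
      rOut := 1 / ((k : ℝ) + 1)
      rIn_pos := by positivity
      rIn_lt_rOut := half_lt_self (by positivity) }
  have hb1 : ∀ k, (b k).rOut ≤ 1 := fun k => by
    change 1 / ((k : ℝ) + 1) ≤ 1
    rw [div_le_one (by positivity)]
    linarith [k.cast_nonneg (α := ℝ)]
  have hb : Tendsto (fun k => (b k).rOut) atTop (𝓝 0) := tendsto_one_div_add_atTop_nhds_zero_nat
  have hgl : LocallyIntegrable g (volume : Measure (Pos n)) := hg.continuous.locallyIntegrable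
  have hs : ∀ k, ContDiff ℝ (∞ : ℕ∞ω) (convolution ((b k).normed volume) g
      (ContinuousLinearMap.lsmul ℝ ℝ) volume) := fun k =>
    (b k).hasCompactSupport_normed.contDiff_convolution_left _ (b k).contDiff_normed hgl
  have hcs : ∀ k, HasCompactSupport (convolution ((b k).normed volume) g
      (ContinuousLinearMap.lsmul ℝ ℝ) volume) := fun k =>
    (b k).hasCompactSupport_normed.convolution _ hc
  have hg' : Continuous fun s => fderiv ℝ g s (EuclideanSpace.single i (1 : ℝ)) :=
    (hg.continuous_fderiv one_ne_zero).clm_apply continuous_const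
  have hg'c : HasCompactSupport fun s => fderiv ℝ g s (EuclideanSpace.single i (1 : ℝ)) :=
    hc.fderiv_apply ℝ _
  -- The derivative is put on `g` instead of the mollifier, so that the derivative of the
  -- mollification is the mollification of the derivative and the same L² convergence applies.
  have hder : ∀ k x, lineDeriv ℝ (convolution ((b k).normed volume) g
      (ContinuousLinearMap.lsmul ℝ ℝ) volume) x (EuclideanSpace.single i (1 : ℝ)) =
      convolution ((b k).normed volume) (fun s => fderiv ℝ g s (EuclideanSpace.single i (1 : ℝ)))
        (ContinuousLinearMap.lsmul ℝ ℝ) volume x := by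
    intro k x
    have hbl : LocallyIntegrable ((b k).normed (volume : Measure (Pos n)))
        (volume : Measure (Pos n)) := (b k).continuous_normed.locallyIntegrable
    rw [((hc.hasFDerivAt_convolution_right (ContinuousLinearMap.lsmul ℝ ℝ) hbl hg
      x).hasLineDerivAt _).lineDeriv]
    exact convolution_precompR_apply _ hbl (hc.fderiv ℝ) (hg.continuous_fderiv one_ne_zero) x _
  refine exists_momentum_of_tendsto i (u := fun k => (hcs k).toSchwartzMap (hs k)) ?_ ?_
  · rw [Lp.tendsto_Lp_iff_tendsto_eLpNorm']
    refine (tendsto_eLpNorm_convolution_sub hg.continuous hc hb1 hb).congr fun k => ?_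
    apply eLpNorm_congr_ae
    filter_upwards [((hcs k).toSchwartzMap (hs k)).coeFn_toLp 2 (volume : Measure (Pos n)), hφ]
      with s h1 h2
    rw [Pi.sub_apply, Pi.sub_apply, h1, h2]
    rfl
  · rw [Lp.tendsto_Lp_iff_tendsto_eLpNorm']
    refine (tendsto_eLpNorm_convolution_sub hg' hg'c hb1 hb).congr fun k => ?_
    apply eLpNorm_congr_ae
    filter_upwards [(∂_{EuclideanSpace.single i (1 : ℝ)}
      ((hcs k).toSchwartzMap (hs k))).coeFn_toLp 2 (volume : Measure (Pos n)), hχ] with s h1 h2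
    rw [Pi.sub_apply, Pi.sub_apply, h1, h2, SchwartzMap.lineDerivOp_apply, ← hder]
    rfl

end Momentum

/-! ### Oscillatory integrals -/

section Oscillatory

/-! ### Slices of a Schwartz function and uniform decay of their Fourier transforms. -/

variable {n : ℕ} {K : Type*} [NormedAddCommGroup K] [NormedSpace ℂ K]

/-- The slice is a translate of χ composed with the inclusion x ↦ (x, 0), a linear map of norm at
most 1. Schwartz seminorms of slices are thereby bounded independently of `w`. -/
theorem norm_iteratedFDeriv_slice_le (χ : 𝓢(Pos n × Pos n, ℂ)) (w x : Pos n) (k l : ℕ) :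
    ‖x‖ ^ k * ‖iteratedFDeriv ℝ l (fun x => χ (x, w)) x‖ ≤
      ‖(x, w)‖ ^ k * ‖iteratedFDeriv ℝ l χ (x, w)‖ := by
  have e : (fun x => χ (x, w)) =
      (fun z => χ (z + (0, w))) ∘ ContinuousLinearMap.inl ℝ (Pos n) (Pos n) := by
    ext x
    simp
  have hs : ContDiff ℝ ∞ fun z : Pos n × Pos n => χ (z + (0, w)) :=
    (χ.smooth ⊤).comp (contDiff_id.add contDiff_const)
  rw [e, (ContinuousLinearMap.inl ℝ (Pos n) (Pos n)).iteratedFDeriv_comp_right hs x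
    (mod_cast le_top), iteratedFDeriv_comp_add_right]
  have hz : (ContinuousLinearMap.inl ℝ (Pos n) (Pos n)) x + (0, w) = (x, w) := by simp
  rw [hz]
  gcongr
  · exact norm_fst_le (x, w)
  · refine (ContinuousMultilinearMap.norm_compContinuousLinearMap_le _ _).trans ?_
    refine mul_le_of_le_one_right (norm_nonneg _) (Finset.prod_le_one (fun _ _ => norm_nonneg _)
      fun _ _ => ContinuousLinearMap.norm_inl_le_one ℝ _ _)

/-- The restriction of a Schwartz function to the slice `ℝⁿ × {w}`. -/
def schwartzSlice (χ : 𝓢(Pos n × Pos n, ℂ)) (w : Pos n) : 𝓢(Pos n, ℂ) where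
  toFun x := χ (x, w)
  smooth' := (χ.smooth ⊤).comp (contDiff_id.prodMk contDiff_const)
  decay' k l := ⟨SchwartzMap.seminorm ℝ k l χ, fun x =>
    (norm_iteratedFDeriv_slice_le χ w x k l).trans (SchwartzMap.le_seminorm ℝ k l χ (x, w))⟩

theorem seminorm_schwartzSlice_le (χ : 𝓢(Pos n × Pos n, ℂ)) (w : Pos n) (k l : ℕ) :
    SchwartzMap.seminorm ℂ k l (schwartzSlice χ w) ≤ SchwartzMap.seminorm ℂ k l χ :=
  SchwartzMap.seminorm_le_bound ℂ k l _ (by positivity) fun x =>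
    (norm_iteratedFDeriv_slice_le χ w x k l).trans (SchwartzMap.le_seminorm ℂ k l χ (x, w))

/-- The bound is packaged as a continuous seminorm so that it can be pulled back along the Fourier
transform. -/
theorem exists_one_add_norm_pow_mul_le {E F : Type*} [NormedAddCommGroup E] [NormedSpace ℝ E]
    [NormedAddCommGroup F] [NormedSpace ℂ F] (k : ℕ) :
    ∃ q : Seminorm ℂ 𝓢(E, F), Continuous q ∧ ∀ f : 𝓢(E, F), ∀ x,
      ‖f x‖ ≤ q f * (1 + ‖x‖) ^ (-(k : ℝ)) := by
  refine ⟨(2 ^ k : NNReal) • ((Finset.Iic (k, 0)).sup fun m => SchwartzMap.seminorm ℂ m.1 m.2),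
    ?_, fun f x => ?_⟩
  · refine Continuous.const_smul ?_ (2 ^ k : NNReal)
    refine Seminorm.continuous_of_le (q := ∑ m ∈ Finset.Iic (k, 0),
      SchwartzMap.seminorm ℂ m.1 m.2) ?_ (Seminorm.finset_sup_le_sum _ _)
    rw [show ⇑(∑ m ∈ Finset.Iic (k, 0), SchwartzMap.seminorm ℂ m.1 m.2 :
      Seminorm ℂ 𝓢(E, F)) = fun f => ∑ m ∈ Finset.Iic (k, 0), SchwartzMap.seminorm ℂ m.1 m.2 f from
      funext fun f => by simp]
    exact continuous_finsetSum _ fun m _ =>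
      (schwartz_withSeminorms ℂ E F).continuous_seminorm m
  · have h := SchwartzMap.one_add_le_sup_seminorm_apply (𝕜 := ℂ) (m := (k, 0)) (k := k) (n := 0)
      le_rfl le_rfl f x
    rw [norm_iteratedFDeriv_zero] at h
    have hp : 0 < 1 + ‖x‖ := by positivity
    rw [Real.rpow_neg hp.le, Real.rpow_natCast, ← div_eq_mul_inv, le_div_iff₀ (by positivity),
      mul_comm]
    exact h

/-- Continuity of the Fourier transform bounds the decay seminorm by finitely many seminorms of the
slice, and each of these is at most the same seminorm of χ. Uniformity in `w` is what dominated
convergence needs later. -/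
theorem exists_norm_fourier_schwartzSlice_le (χ : 𝓢(Pos n × Pos n, ℂ)) (k : ℕ) :
    ∃ C : ℝ, ∀ w u, ‖(FourierTransform.fourier (schwartzSlice χ w) : 𝓢(Pos n, ℂ)) u‖ ≤
      C * (1 + ‖u‖) ^ (-(k : ℝ)) := by
  obtain ⟨q, hq, hle⟩ := exists_one_add_norm_pow_mul_le (E := Pos n) (F := ℂ) k
  let T := SchwartzMap.fourierTransformCLM ℂ (E := ℂ) (V := Pos n)
  obtain ⟨s, C, -, hC⟩ := Seminorm.bound_of_continuous (schwartz_withSeminorms ℂ (Pos n) ℂ)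
    (q.comp T.toLinearMap) (hq.comp T.continuous)
  refine ⟨C • (s.sup (schwartzSeminormFamily ℂ (Pos n × Pos n) ℂ)) χ, fun w u => ?_⟩
  refine (hle _ u).trans ?_
  gcongr
  refine (hC (schwartzSlice χ w)).trans ?_
  change C • (s.sup (schwartzSeminormFamily ℂ (Pos n) ℂ)) (schwartzSlice χ w) ≤ _
  gcongr
  refine Seminorm.finset_sup_apply_le (by positivity) fun m hm => ?_
  exact (seminorm_schwartzSlice_le χ w m.1 m.2).trans
    (Seminorm.le_finset_sup_apply (p := schwartzSeminormFamily ℂ (Pos n × Pos n) ℂ) hm)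

theorem integrable_one_add_norm_neg (n : ℕ) :
    Integrable (fun x : Pos n => (1 + ‖x‖) ^ (-((n + 1 : ℕ) : ℝ))) volume :=
  integrable_one_add_norm (by simp)

theorem continuous_fourier_schwartzSlice (χ : 𝓢(Pos n × Pos n, ℂ)) :
    Continuous fun z : Pos n × Pos n =>
      (FourierTransform.fourier (schwartzSlice χ z.1) : 𝓢(Pos n, ℂ)) z.2 := by
  obtain ⟨q, -, hle⟩ := exists_one_add_norm_pow_mul_le (E := Pos n × Pos n) (F := ℂ) (n + 1)
  have e : (fun z : Pos n × Pos n =>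
      (FourierTransform.fourier (schwartzSlice χ z.1) : 𝓢(Pos n, ℂ)) z.2) =
      fun z => ∫ x, cexp (↑(-2 * Real.pi * inner ℝ x z.2) * I) • χ (x, z.1) := by
    ext z
    rw [SchwartzMap.fourier_coe, Real.fourier_eq']
    rfl
  rw [e]
  refine continuous_of_dominated (bound := fun x => q χ * (1 + ‖x‖) ^ (-((n + 1 : ℕ) : ℝ)))
    (fun z => ?_) (fun z => ae_of_all _ fun x => ?_) ((integrable_one_add_norm_neg n).const_mul _)
    (ae_of_all _ fun x => ?_)
  · have := χ.continuous
    exact Continuous.aestronglyMeasurable (by fun_prop)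
  · rw [norm_smul, Complex.norm_exp_ofReal_mul_I, one_mul]
    refine (hle χ (x, z.1)).trans ?_
    have h := norm_fst_le (x, z.1)
    refine mul_le_mul_of_nonneg_left ?_ (apply_nonneg q χ)
    rw [Real.rpow_neg (by positivity), Real.rpow_neg (by positivity)]
    simp only [Real.rpow_natCast]
    gcongr
  · have := χ.continuous
    fun_prop

/-! ### Regularized oscillatory integrals: integrability, limit, integration by parts. -/

theorem continuous_pairing {X : Type*} [TopologicalSpace X] {f g : X → Pos n} (hf : Continuous f)
    (hg : Continuous g) : Continuous fun z => pairing (f z) (g z) := by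
  unfold pairing
  fun_prop

theorem norm_osc_mul (χ : 𝓢(Pos n × Pos n, ℂ)) (ε : ℝ) (z : Pos n × Pos n) :
    ‖χ (ε • z) * cexp (-I * (pairing z.1 z.2 : ℝ))‖ = ‖χ (ε • z)‖ := by
  rw [norm_mul, show -I * ((pairing z.1 z.2 : ℝ) : ℂ) = ((-pairing z.1 z.2 : ℝ) : ℂ) * I by
    push_cast; ring, Complex.norm_exp_ofReal_mul_I, mul_one]

theorem continuous_osc_mul (χ : 𝓢(Pos n × Pos n, ℂ)) (ε : ℝ) :
    Continuous fun z : Pos n × Pos n => χ (ε • z) * cexp (-I * (pairing z.1 z.2 : ℝ)) := by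
  have h := continuous_pairing (n := n) (continuous_fst (X := Pos n) (Y := Pos n)) continuous_snd
  have h2 : Continuous fun z : Pos n × Pos n => χ (ε • z) :=
    χ.continuous.comp (continuous_const_smul ε)
  have h3 := Complex.continuous_ofReal.comp h
  exact h2.mul (Complex.continuous_exp.comp (continuous_const.mul h3))

instance isAddHaarMeasure_volume_prod :
    (volume : Measure (Pos n × Pos n)).IsAddHaarMeasure :=
  inferInstanceAs (Measure.prod (volume : Measure (Pos n)) volume).IsAddHaarMeasure

/-- Linear growth is all that occurs, the deformed integrands being affine in (x, y); the zeroth and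
first moments of the rescaled cut-off dominate. -/
theorem integrable_osc (χ : 𝓢(Pos n × Pos n, ℂ)) {ε : ℝ} (hε : ε ≠ 0)
    {b : Pos n × Pos n → K} (hb : Continuous b) {C : ℝ} (hC : ∀ z, ‖b z‖ ≤ C * (1 + ‖z‖)) :
    Integrable (fun z : Pos n × Pos n =>
      (χ (ε • z) * cexp (-I * (pairing z.1 z.2 : ℝ))) • b z) := by
  let f : 𝓢(Pos n × Pos n, ℂ) := SchwartzMap.compCLMOfContinuousLinearEquiv ℂ
    (ContinuousLinearEquiv.smulLeft (R₁ := ℝ) (M₁ := Pos n × Pos n) (Units.mk0 ε hε)) χ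
  have hf : ∀ z, f z = χ (ε • z) := fun z => rfl
  have h0 := f.integrable_pow_mul (volume : Measure (Pos n × Pos n)) 0
  have h1 := f.integrable_pow_mul (volume : Measure (Pos n × Pos n)) 1
  refine ((h0.add h1).const_mul C).mono'
    ((continuous_osc_mul χ ε).smul hb).aestronglyMeasurable (ae_of_all _ fun z => ?_)
  rw [norm_smul, norm_osc_mul, ← hf]
  refine (mul_le_mul_of_nonneg_left (hC z) (norm_nonneg _)).trans (le_of_eq ?_)
  simp only [Pi.add_apply, pow_zero, pow_one]
  ring

/-- Integrating over x first yields ε⁻ⁿ times the Fourier transform of the slice χ(·, εy) at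
y/(2πε). Substituting y = 2πεu then cancels every power of ε and 2π, so that ε survives only inside
the arguments. -/
theorem integral_osc_eq [CompleteSpace K] (χ : 𝓢(Pos n × Pos n, ℂ)) {ε : ℝ} (hε : 0 < ε)
    {V : Pos n → K} (hV : Continuous V) {M : ℝ} (hM : ∀ y, ‖V y‖ ≤ M) :
    (((2 * Real.pi : ℝ) : ℂ) ^ n)⁻¹ • ∫ z : Pos n × Pos n,
      (χ (ε • z) * cexp (-I * (pairing z.1 z.2 : ℝ))) • V z.2 =
    ∫ u : Pos n, (FourierTransform.fourier
      (schwartzSlice χ ((2 * Real.pi * ε ^ 2) • u)) : 𝓢(Pos n, ℂ)) u •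
        V ((2 * Real.pi * ε) • u) := by
  have hM0 : 0 ≤ M := (norm_nonneg _).trans (hM 0)
  have hint := integrable_osc χ hε.ne' (b := fun z => V z.2) (hV.comp continuous_snd) (C := M)
    fun z => (hM z.2).trans (le_mul_of_one_le_right hM0 (by linarith [norm_nonneg z]))
  have hp : 0 < 2 * Real.pi * ε := by positivity
  rw [Measure.volume_eq_prod] at hint ⊢
  rw [integral_prod_symm _ hint]
  have inner_eq : ∀ y : Pos n, (∫ x : Pos n,
      (χ (ε • (x, y)) * cexp (-I * (pairing x y : ℝ))) • V y) =
      ((ε ^ n)⁻¹ • (FourierTransform.fourier (schwartzSlice χ (ε • y)) : 𝓢(Pos n, ℂ))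
        ((2 * Real.pi * ε)⁻¹ • y)) • V y := by
    intro y
    rw [integral_smul_const]
    congr 1
    have h := Measure.integral_comp_smul_of_nonneg (volume : Measure (Pos n))
      (fun x => cexp (↑(-2 * Real.pi * inner ℝ x ((2 * Real.pi * ε)⁻¹ • y)) * I) • χ (x, ε • y))
      ε (hR := hε.le)
    rw [finrank_euclideanSpace_fin] at h
    rw [SchwartzMap.fourier_coe, Real.fourier_eq']
    refine Eq.trans ?_ h
    congr 1
    ext x
    rw [Prod.smul_mk, smul_eq_mul, mul_comm, real_inner_smul_left, real_inner_smul_right]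
    congr 2
    rw [pairing_eq_inner]
    have h3 : -2 * Real.pi * (ε * ((2 * Real.pi * ε)⁻¹ * inner ℝ x y)) = - inner ℝ x y := by
      field_simp
    rw [h3]
    push_cast
    ring
  simp only [inner_eq]
  have h := Measure.integral_comp_smul_of_nonneg (volume : Measure (Pos n))
    (fun y => ((ε ^ n)⁻¹ • (FourierTransform.fourier (schwartzSlice χ (ε • y)) : 𝓢(Pos n, ℂ))
        ((2 * Real.pi * ε)⁻¹ • y)) • V y) (2 * Real.pi * ε) (hR := hp.le)
  rw [finrank_euclideanSpace_fin, eq_inv_smul_iff₀ (by positivity)] at h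
  rw [← h, ← integral_smul, ← integral_smul]
  congr 1
  ext u
  have e1 : ε • (2 * Real.pi * ε) • u = (2 * Real.pi * ε ^ 2) • u := by
    rw [smul_smul]
    congr 1
    ring
  rw [e1, inv_smul_smul₀ hp.ne']
  simp only [← Complex.coe_smul, smul_smul, smul_eq_mul]
  congr 1
  push_cast
  have h1 : (ε : ℂ) ≠ 0 := by exact_mod_cast hε.ne'
  have h2 : (Real.pi : ℂ) ≠ 0 := by exact_mod_cast Real.pi_ne_zero
  field_simp
  rw [mul_pow (2 * (Real.pi : ℂ))]

/-- After `integral_osc_eq`, dominated convergence lets ε → 0 under the integral. What remains is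
V(0) times the integral of the Fourier transform of χ(·, 0), which equals χ(0, 0) by Fourier
inversion at the origin. -/
theorem tendsto_osc (χ : 𝓢(Pos n × Pos n, ℂ)) {V : Pos n → K} [CompleteSpace K]
    (hV : Continuous V) {M : ℝ} (hM : ∀ y, ‖V y‖ ≤ M) :
    Tendsto (fun ε : ℝ => (((2 * Real.pi : ℝ) : ℂ) ^ n)⁻¹ • ∫ z : Pos n × Pos n,
      (χ (ε • z) * cexp (-I * (pairing z.1 z.2 : ℝ))) • V z.2) (𝓝[>] 0) (𝓝 (χ 0 • V 0)) := by
  have hM0 : 0 ≤ M := (norm_nonneg _).trans (hM 0)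
  obtain ⟨C, hC⟩ := exists_norm_fourier_schwartzSlice_le χ (n + 1)
  have h0 : χ 0 • V 0 = ∫ u : Pos n, (FourierTransform.fourier
      (schwartzSlice χ ((2 * Real.pi * (0 : ℝ) ^ 2) • u)) : 𝓢(Pos n, ℂ)) u •
        V ((2 * Real.pi * (0 : ℝ)) • u) := by
    simp only [ne_eq, OfNat.ofNat_ne_zero, not_false_eq_true, zero_pow, mul_zero, zero_smul]
    rw [integral_smul_const]
    congr 1
    have h : (FourierTransformInv.fourierInv (FourierTransform.fourier (schwartzSlice χ 0)) :
      𝓢(Pos n, ℂ)) 0 = χ 0 := by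
      rw [FourierTransform.fourierInv_fourier_eq]
      rfl
    rw [← h, SchwartzMap.fourierInv_coe, Real.fourierInv_eq']
    simp
  rw [h0]
  have hlim : Tendsto (fun ε : ℝ => ∫ u : Pos n, (FourierTransform.fourier
      (schwartzSlice χ ((2 * Real.pi * ε ^ 2) • u)) : 𝓢(Pos n, ℂ)) u •
        V ((2 * Real.pi * ε) • u)) (𝓝 0) (𝓝 (∫ u : Pos n, (FourierTransform.fourier
      (schwartzSlice χ ((2 * Real.pi * (0 : ℝ) ^ 2) • u)) : 𝓢(Pos n, ℂ)) u •
        V ((2 * Real.pi * (0 : ℝ)) • u))) := by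
    refine Continuous.tendsto (f := fun ε : ℝ => ∫ u : Pos n, (FourierTransform.fourier
      (schwartzSlice χ ((2 * Real.pi * ε ^ 2) • u)) : 𝓢(Pos n, ℂ)) u •
        V ((2 * Real.pi * ε) • u)) ?_ 0
    refine continuous_of_dominated
      (bound := fun u => C * (1 + ‖u‖) ^ (-((n + 1 : ℕ) : ℝ)) * M)
      (fun ε => ?_) (fun ε => ae_of_all _ fun u => ?_)
      (((integrable_one_add_norm_neg n).const_mul _).mul_const _) (ae_of_all _ fun u => ?_)
    · refine Continuous.aestronglyMeasurable ?_
      refine ((continuous_fourier_schwartzSlice χ).comp (f := fun u : Pos n =>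
        ((2 * Real.pi * ε ^ 2) • u, u)) (by fun_prop)).smul (by fun_prop)
    · rw [norm_smul]
      exact mul_le_mul (hC _ _) (hM _) (norm_nonneg _) ((norm_nonneg _).trans (hC 0 u))
    · refine ((continuous_fourier_schwartzSlice χ).comp (f := fun ε : ℝ =>
        ((2 * Real.pi * ε ^ 2) • u, u)) (by fun_prop)).smul (by fun_prop)
  refine (hlim.mono_left nhdsWithin_le_nhds).congr' ?_
  filter_upwards [self_mem_nhdsWithin] with ε hε
  exact (integral_osc_eq χ hε hV hM).symm

/-- Working with a direction v in the product space treats both variables at once: v = (0, e_l)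
brings down the factor x_l from the phase, and v = (e_l, 0) brings down y_l. Differentiating the
cut-off costs a factor ε. -/
theorem hasLineDerivAt_osc_mul (χ : 𝓢(Pos n × Pos n, ℂ)) (ε : ℝ) (z v : Pos n × Pos n) :
    HasLineDerivAt ℝ (fun z : Pos n × Pos n => χ (ε • z) * cexp (-I * (pairing z.1 z.2 : ℝ)))
      (ε * ((∂_{v} χ) (ε • z) * cexp (-I * (pairing z.1 z.2 : ℝ))) -
        I * ((χ (ε • z) * cexp (-I * (pairing z.1 z.2 : ℝ))) *
          ((pairing v.1 z.2 + pairing z.1 v.2 : ℝ) : ℂ))) z v := by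
  have h1 : HasDerivAt (fun t : ℝ => χ (ε • (z + t • v))) (ε * (∂_{v} χ) (ε • z)) 0 := by
    have hl : HasDerivAt (fun t : ℝ => ε • (z + t • v)) (ε • v) 0 := by
      have := (((hasDerivAt_id (0 : ℝ)).smul_const v).const_add z).const_smul ε
      rw [one_smul] at this
      exact this
    have hχ := χ.hasFDerivAt (ε • (z + (0 : ℝ) • v))
    have := hχ.comp_hasDerivAt (0 : ℝ) hl
    rw [zero_smul, add_zero, map_smul, Complex.real_smul] at this
    rw [SchwartzMap.lineDerivOp_apply_eq_fderiv]
    exact this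
  have h2 : HasDerivAt (fun t : ℝ => pairing (z + t • v).1 (z + t • v).2)
      (pairing v.1 z.2 + pairing z.1 v.2) 0 := by
    unfold pairing
    rw [← Finset.sum_add_distrib]
    refine HasDerivAt.fun_sum fun k _ => ?_
    have e1 : HasDerivAt (fun t : ℝ => (z + t • v).1 k) (v.1 k) 0 := by
      simpa using ((hasDerivAt_id (0 : ℝ)).mul_const (v.1 k)).const_add (z.1 k)
    have e2 : HasDerivAt (fun t : ℝ => (z + t • v).2 k) (v.2 k) 0 := by
      simpa using ((hasDerivAt_id (0 : ℝ)).mul_const (v.2 k)).const_add (z.2 k)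
    have h := e1.mul e2
    simp only [zero_smul, add_zero] at h
    exact h
  have h3 : HasDerivAt (fun t : ℝ =>
      cexp (-I * (pairing (z + t • v).1 (z + t • v).2 : ℝ)))
      (cexp (-I * (pairing z.1 z.2 : ℝ)) *
        (-I * ((pairing v.1 z.2 + pairing z.1 v.2 : ℝ) : ℂ))) 0 := by
    simpa using (h2.ofReal_comp.const_mul (-I)).cexp
  have h := h1.mul h3
  simp only [zero_smul, add_zero] at h
  exact h.congr_deriv (by ring)

theorem integral_smul_by_parts {X : Type*} [NormedAddCommGroup X] [NormedSpace ℝ X]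
    [FiniteDimensional ℝ X] [MeasurableSpace X] [BorelSpace X] {μ : Measure X}
    [μ.IsAddHaarMeasure] {f f₁ c : X → ℂ} {ε : ℂ} {V V' : X → K} {v : X}
    (i1 : Integrable (fun z => f z • V z) μ) (i2 : Integrable (fun z => f z • V' z) μ)
    (i3 : Integrable (fun z => f₁ z • V z) μ) (i4 : Integrable (fun z => f z • c z • V z) μ)
    (hf : ∀ z, HasLineDerivAt ℝ f (ε * f₁ z - I * (f z * c z)) z v)
    (hV : ∀ z, HasLineDerivAt ℝ V (V' z) z v) :
    ∫ z, f z • c z • V z ∂μ = -(I • ∫ z, f z • V' z ∂μ) - I • ε • ∫ z, f₁ z • V z ∂μ := by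
  have i3' : Integrable (fun z => ε • (f₁ z • V z)) μ := i3.smul ε
  have i4' : Integrable (fun z => I • f z • c z • V z) μ := i4.smul I
  have e : (fun z => (ε * f₁ z - I * (f z * c z)) • V z) =
      fun z => ε • (f₁ z • V z) - I • (f z • c z • V z) := by
    ext z
    rw [sub_smul]
    simp only [smul_smul]
  have i5 : Integrable (fun z => (ε * f₁ z - I * (f z * c z)) • V z) μ := by
    rw [e]
    exact i3'.sub i4'
  have hparts := integral_bilinear_hasLineDerivAt_right_eq_neg_left_of_integrable
    (B := ContinuousLinearMap.lsmul ℝ ℂ) i5 i2 i1 (fun z _ => hf z) (fun z _ => hV z)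
  simp only [ContinuousLinearMap.lsmul_apply] at hparts
  rw [e, integral_sub i3' i4', integral_smul, integral_smul] at hparts
  rw [hparts, smul_neg, smul_sub, smul_smul I I, I_mul_I]
  module

theorem integral_osc_by_parts (χ : 𝓢(Pos n × Pos n, ℂ)) {ε : ℝ} (hε : 0 < ε) {V V' : Pos n → K}
    (hV : Continuous V) {M : ℝ} (hM : ∀ y, ‖V y‖ ≤ M)
    (hV' : Continuous V') {M' : ℝ} (hM' : ∀ y, ‖V' y‖ ≤ M') (v : Pos n × Pos n)
    (hd : ∀ z : Pos n × Pos n, HasLineDerivAt ℝ (fun z : Pos n × Pos n => V z.2) (V' z.2) z v) :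
    Integrable (fun z : Pos n × Pos n => (χ (ε • z) * cexp (-I * (pairing z.1 z.2 : ℝ))) •
      ((pairing v.1 z.2 + pairing z.1 v.2 : ℝ) : ℂ) • V z.2) ∧
    ∫ z : Pos n × Pos n, (χ (ε • z) * cexp (-I * (pairing z.1 z.2 : ℝ))) •
      ((pairing v.1 z.2 + pairing z.1 v.2 : ℝ) : ℂ) • V z.2 =
    -(I • ∫ z : Pos n × Pos n, (χ (ε • z) * cexp (-I * (pairing z.1 z.2 : ℝ))) • V' z.2) -
      I • (ε : ℂ) • ∫ z : Pos n × Pos n,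
        ((∂_{v} χ) (ε • z) * cexp (-I * (pairing z.1 z.2 : ℝ))) • V z.2 := by
  have hM0 : 0 ≤ M := (norm_nonneg _).trans (hM 0)
  have hM0' : 0 ≤ M' := (norm_nonneg _).trans (hM' 0)
  have i1 : Integrable (fun z : Pos n × Pos n => (χ (ε • z) *
      cexp (-I * (pairing z.1 z.2 : ℝ))) • V z.2) :=
    integrable_osc χ hε.ne' (b := fun z => V z.2) (hV.comp continuous_snd) (C := M)
      fun z => (hM z.2).trans (le_mul_of_one_le_right hM0 (by linarith [norm_nonneg z]))
  have i2 : Integrable (fun z : Pos n × Pos n => (χ (ε • z) *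
      cexp (-I * (pairing z.1 z.2 : ℝ))) • V' z.2) :=
    integrable_osc χ hε.ne' (b := fun z => V' z.2) (hV'.comp continuous_snd) (C := M')
      fun z => (hM' z.2).trans (le_mul_of_one_le_right hM0' (by linarith [norm_nonneg z]))
  have i3 : Integrable (fun z : Pos n × Pos n => ((∂_{v} χ) (ε • z) *
      cexp (-I * (pairing z.1 z.2 : ℝ))) • V z.2) :=
    integrable_osc (∂_{v} χ) hε.ne' (b := fun z => V z.2) (hV.comp continuous_snd) (C := M)
      fun z => (hM z.2).trans (le_mul_of_one_le_right hM0 (by linarith [norm_nonneg z]))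
  have i4 : Integrable (fun z : Pos n × Pos n => (χ (ε • z) *
      cexp (-I * (pairing z.1 z.2 : ℝ))) •
      ((pairing v.1 z.2 + pairing z.1 v.2 : ℝ) : ℂ) • V z.2) := by
    refine integrable_osc χ hε.ne' (b := fun z =>
      ((pairing v.1 z.2 + pairing z.1 v.2 : ℝ) : ℂ) • V z.2) ?_
      (C := (‖v.1‖ + ‖v.2‖) * M) fun z => ?_
    · exact (Complex.continuous_ofReal.comp ((continuous_pairing continuous_const
        continuous_snd).add (continuous_pairing continuous_fst continuous_const))).smul
        (hV.comp continuous_snd)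
    · rw [norm_smul, Complex.norm_real]
      have h1 : ‖pairing v.1 z.2 + pairing z.1 v.2‖ ≤ (‖v.1‖ + ‖v.2‖) * (1 + ‖z‖) := by
        have a1 := abs_pairing_le v.1 z.2
        have a2 := abs_pairing_le z.1 v.2
        have a3 := mul_le_mul_of_nonneg_left (norm_snd_le z) (norm_nonneg v.1)
        have a4 := mul_le_mul_of_nonneg_left (norm_fst_le z) (norm_nonneg v.2)
        have a5 := abs_add_le (pairing v.1 z.2) (pairing z.1 v.2)
        rw [Real.norm_eq_abs]
        nlinarith [norm_nonneg v.1, norm_nonneg v.2]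
      calc _ ≤ (‖v.1‖ + ‖v.2‖) * (1 + ‖z‖) * M :=
            mul_le_mul h1 (hM z.2) (norm_nonneg _) (by positivity)
        _ = _ := by ring
  exact ⟨i4, integral_smul_by_parts i1 i2 i3 i4 (fun z => hasLineDerivAt_osc_mul χ ε z v) hd⟩

/-! ### Evaluation rules and linearity for oscillatory integrals. -/

section HasOscillatoryIntegral

theorem hasOscillatoryIntegral_snd [CompleteSpace K] {V : Pos n → K}
    (hV : Continuous V) {M : ℝ} (hM : ∀ y, ‖V y‖ ≤ M) :
    HasOscillatoryIntegral (fun _ y => V y) (V 0) := by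
  intro χ hχ
  have hM0 : 0 ≤ M := (norm_nonneg _).trans (hM 0)
  refine ⟨fun ε hε => integrable_osc χ hε.ne' (b := fun z => V z.2) (hV.comp continuous_snd)
    (C := M) fun z => (hM z.2).trans (le_mul_of_one_le_right hM0 (by linarith [norm_nonneg z])), ?_⟩
  simpa [hχ] using tendsto_osc χ hV hM

/-- In the integration by parts, the term with ∂_v χ is ε times a convergent expression and
disappears in the limit, leaving the integral of V'. -/
theorem hasOscillatoryIntegral_pairing_smul [CompleteSpace K] {V V' : Pos n → K}
    (hV : Continuous V) {M : ℝ} (hM : ∀ y, ‖V y‖ ≤ M)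
    (hV' : Continuous V') {M' : ℝ} (hM' : ∀ y, ‖V' y‖ ≤ M') (v : Pos n × Pos n)
    (hd : ∀ z : Pos n × Pos n, HasLineDerivAt ℝ (fun z : Pos n × Pos n => V z.2) (V' z.2) z v) :
    HasOscillatoryIntegral (fun x y => ((pairing v.1 y + pairing x v.2 : ℝ) : ℂ) • V y)
      (-(I • V' 0)) := by
  intro χ hχ
  refine ⟨fun ε hε => (integral_osc_by_parts χ hε hV hM hV' hM' v hd).1, ?_⟩
  have h1 := (tendsto_osc χ hV' hM').const_smul (-I)
  have h2 := tendsto_osc (∂_{v} χ) hV hM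
  have h3 : Tendsto (fun ε : ℝ => I * (ε : ℂ)) (𝓝[>] 0) (𝓝 0) := by
    have : Continuous fun ε : ℝ => I * (ε : ℂ) := by fun_prop
    simpa using (this.tendsto 0).mono_left nhdsWithin_le_nhds
  have h4 := h1.sub (h3.smul h2)
  rw [hχ, one_smul, zero_smul, sub_zero, neg_smul] at h4
  refine h4.congr' ?_
  filter_upwards [self_mem_nhdsWithin] with ε hε
  rw [(integral_osc_by_parts χ hε hV hM hV' hM' v hd).2]
  module

theorem hasOscillatoryIntegral_fst_smul [CompleteSpace K] {V V' : Pos n → K}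
    (hV : Continuous V) {M : ℝ} (hM : ∀ y, ‖V y‖ ≤ M)
    (hV' : Continuous V') {M' : ℝ} (hM' : ∀ y, ‖V' y‖ ≤ M') (l : Fin n)
    (hd : ∀ y, HasLineDerivAt ℝ V (V' y) y (EuclideanSpace.single l (1 : ℝ))) :
    HasOscillatoryIntegral (fun x y => (x l : ℂ) • V y) (-(I • V' 0)) := by
  have h := hasOscillatoryIntegral_pairing_smul hV hM hV' hM'
    ((0 : Pos n), EuclideanSpace.single l (1 : ℝ)) (fun z => hd z.2)
  simpa [pairing] using h

/-- Here y_l comes from differentiating the phase in x, on which V does not depend; hence the value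
0. -/
theorem hasOscillatoryIntegral_snd_smul [CompleteSpace K] {V : Pos n → K}
    (hV : Continuous V) {M : ℝ} (hM : ∀ y, ‖V y‖ ≤ M) (l : Fin n) :
    HasOscillatoryIntegral (fun _ y => (y l : ℂ) • V y) 0 := by
  have h := hasOscillatoryIntegral_pairing_smul hV hM (V' := fun _ => 0) continuous_const (M' := 0)
    (by simp) (EuclideanSpace.single l (1 : ℝ), (0 : Pos n)) (fun z => by
      simpa [HasLineDerivAt] using hasDerivAt_const (0 : ℝ) (V z.2))
  simpa [pairing] using h

theorem HasOscillatoryIntegral.add {b b' : Pos n → Pos n → K} {v v' : K}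
    (h : HasOscillatoryIntegral b v) (h' : HasOscillatoryIntegral b' v') :
    HasOscillatoryIntegral (fun x y => b x y + b' x y) (v + v') := by
  intro χ hχ
  have i : ∀ ε : ℝ, 0 < ε → _ := fun ε hε => ((h χ hχ).1 ε hε).add ((h' χ hχ).1 ε hε)
  refine ⟨fun ε hε => (i ε hε).congr (ae_of_all _ fun z => (smul_add _ _ _).symm), ?_⟩
  refine ((h χ hχ).2.add (h' χ hχ).2).congr' ?_
  filter_upwards [self_mem_nhdsWithin] with ε hε
  simp only [smul_add]
  rw [integral_add ((h χ hχ).1 ε hε) ((h' χ hχ).1 ε hε), smul_add]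

theorem HasOscillatoryIntegral.clm_apply {b : Pos n → Pos n → K} {v : K} {K' : Type*}
    [NormedAddCommGroup K'] [NormedSpace ℂ K'] [CompleteSpace K] [CompleteSpace K']
    (h : HasOscillatoryIntegral b v) (T : K →L[ℂ] K') :
    HasOscillatoryIntegral (fun x y => T (b x y)) (T v) := by
  intro χ hχ
  refine ⟨fun ε hε => (T.integrable_comp ((h χ hχ).1 ε hε)).congr
    (ae_of_all _ fun z => map_smul T _ _), ?_⟩
  refine ((T.continuous.tendsto v).comp (h χ hχ).2).congr' ?_
  filter_upwards [self_mem_nhdsWithin] with ε hε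
  simp only [Function.comp_apply, map_smul]
  rw [← T.integral_comp_comm ((h χ hχ).1 ε hε)]
  simp only [map_smul]

theorem HasOscillatoryIntegral.const_smul [CompleteSpace K] {b : Pos n → Pos n → K} {v : K}
    (h : HasOscillatoryIntegral b v) (c : ℂ) :
    HasOscillatoryIntegral (fun x y => c • b x y) (c • v) :=
  h.clm_apply (c • ContinuousLinearMap.id ℂ K)

theorem hasOscillatoryIntegral_zero :
    HasOscillatoryIntegral (fun _ _ : Pos n => (0 : K)) 0 := by
  intro χ _
  simp

theorem HasOscillatoryIntegral.sum {ι : Type*} (t : Finset ι) {b : ι → Pos n → Pos n → K}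
    {v : ι → K} (h : ∀ j ∈ t, HasOscillatoryIntegral (b j) (v j)) :
    HasOscillatoryIntegral (fun x y => ∑ j ∈ t, b j x y) (∑ j ∈ t, v j) := by
  classical
  induction t using Finset.induction_on with
  | empty => simpa using hasOscillatoryIntegral_zero
  | insert a t ha ih =>
    simp only [Finset.sum_insert ha]
    exact (h a (Finset.mem_insert_self a t)).add
      (ih fun j hj => h j (Finset.mem_insert_of_mem hj))

/-- The definition quantifies over cut-offs, so uniqueness requires that one with value 1 at the
origin exists; a smooth bump provides it. -/
theorem HasOscillatoryIntegral.unique {b : Pos n → Pos n → K} {v w : K}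
    (hv : HasOscillatoryIntegral b v) (hw : HasOscillatoryIntegral b w) : v = w := by
  let f : ContDiffBump (0 : Pos n × Pos n) := ⟨1, 2, one_pos, one_lt_two⟩
  have hc : HasCompactSupport fun z => (f z : ℂ) := 
    f.hasCompactSupport.comp_left (g := ((↑) : ℝ → ℂ)) Complex.ofReal_zero
  have hs : ContDiff ℝ ∞ fun z => (f z : ℂ) := Complex.ofRealCLM.contDiff.comp f.contDiff
  have h1 : hc.toSchwartzMap hs 0 = 1 := by
    simp [f.one_of_mem_closedBall (Metric.mem_closedBall_self zero_le_one)]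
  exact tendsto_nhds_unique (hv _ h1).2 (hw _ h1).2

end HasOscillatoryIntegral

end Oscillatory

/-! ### Vectors smooth for the abelian group -/

section Smooth

variable {n : ℕ} {Z : Pos n → Pos n} (hZ : Measurable Z)

theorem hasDerivAt_cexp_mul (r : ℝ) :
    HasDerivAt (fun t : ℝ => cexp (I * (t * r : ℝ))) (I * r) 0 := by
  have h : HasDerivAt (fun t : ℝ => t * r) r 0 := by
    simpa using (hasDerivAt_id (0 : ℝ)).mul_const r
  simpa using (h.ofReal_comp.const_mul I).cexp

/-- If `t ↦ U(t e_l) g` is differentiable in norm, its derivative is multiplication by `i Z_l`. -/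
theorem ae_eq_of_hasLineDerivAt_abelianU {g c : Hil n} {l : Fin n}
    (h : HasLineDerivAt ℝ (fun y => abelianU ℂ Z hZ y g) c 0 (EuclideanSpace.single l (1 : ℝ))) :
    c =ᵐ[volume] fun s => I * Z s l * g s := by
  let t : ℕ → ℝ := fun k => 1 / ((k : ℝ) + 1)
  have ht0 : Tendsto t atTop (𝓝 0) := tendsto_one_div_add_atTop_nhds_zero_nat
  have ht : Tendsto t atTop (𝓝[≠] 0) :=
    tendsto_nhdsWithin_iff.2 ⟨ht0, Eventually.of_forall fun k => by
      have : 0 < t k := by positivity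
      exact this.ne'⟩
  let q : ℕ → Hil n := fun k =>
    (t k)⁻¹ • (abelianU ℂ Z hZ (t k • EuclideanSpace.single l (1 : ℝ)) g - g)
  have hq : Tendsto q atTop (𝓝 c) := by
    have h' := h.tendsto_slope_zero.comp ht
    simpa [q, Function.comp_def, abelianU_zero] using h'
  -- Norm convergence of the difference quotients gives almost everywhere convergence along a
  -- subsequence, where the limit can be computed pointwise.
  obtain ⟨ns, hns, hae⟩ := (tendstoInMeasure_of_tendsto_Lp hq).exists_seq_tendsto_ae
  have hqe : ∀ᵐ s ∂(volume : Measure (Pos n)), ∀ k, q k s =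
      (t k)⁻¹ • (cexp (I * (t k * Z s l : ℝ)) - 1) * g s := by
    rw [ae_all_iff]
    intro k
    filter_upwards [Lp.coeFn_smul (t k)⁻¹
        (abelianU ℂ Z hZ (t k • EuclideanSpace.single l (1 : ℝ)) g - g),
      Lp.coeFn_sub (abelianU ℂ Z hZ (t k • EuclideanSpace.single l (1 : ℝ)) g) g,
      coeFn_abelianU hZ (t k • EuclideanSpace.single l (1 : ℝ)) g] with s h1 h2 h3
    rw [h1, Pi.smul_apply, h2, Pi.sub_apply, h3, pairing_smul_left, pairing_single_left]
    simp only [Complex.real_smul, smul_eq_mul]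
    ring
  filter_upwards [hae, hqe] with s h1 h2
  simp only [h2] at h1
  have h3 := (((hasDerivAt_cexp_mul (Z s l)).tendsto_slope_zero.comp
    (ht.comp hns.tendsto_atTop)).mul_const (g s))
  refine tendsto_nhds_unique h1 (h3.congr fun k => ?_)
  simp

theorem exists_lineDeriv_abelianU {g : Hil n}
    (hg : ContDiff ℝ ∞ fun y => abelianU ℂ Z hZ y g) (l : Fin n) :
    ∃ c : Hil n, (c =ᵐ[volume] fun s => I * Z s l * g s) ∧
      (∀ y, HasLineDerivAt ℝ (fun y => abelianU ℂ Z hZ y g) (abelianU ℂ Z hZ y c) y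
        (EuclideanSpace.single l (1 : ℝ))) ∧
      Continuous fun y => abelianU ℂ Z hZ y c := by
  have hd : ∀ y, HasLineDerivAt ℝ (fun y => abelianU ℂ Z hZ y g)
      (fderiv ℝ (fun y => abelianU ℂ Z hZ y g) y (EuclideanSpace.single l (1 : ℝ))) y
      (EuclideanSpace.single l (1 : ℝ)) := fun y =>
    (hg.differentiable (by simp) y).hasFDerivAt.hasLineDerivAt _
  -- By the group law the derivative at `y` is U(y) applied to the derivative at 0.
  have hd' : ∀ y, HasLineDerivAt ℝ (fun y => abelianU ℂ Z hZ y g) (abelianU ℂ Z hZ y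
      (fderiv ℝ (fun y => abelianU ℂ Z hZ y g) 0 (EuclideanSpace.single l (1 : ℝ)))) y
      (EuclideanSpace.single l (1 : ℝ)) := by
    intro y
    have h0 := hd 0
    have h1 : HasDerivAt (fun t : ℝ => abelianU ℂ Z hZ y (abelianU ℂ Z hZ
        (0 + t • EuclideanSpace.single l (1 : ℝ)) g)) (abelianU ℂ Z hZ y
      (fderiv ℝ (fun y => abelianU ℂ Z hZ y g) 0 (EuclideanSpace.single l (1 : ℝ)))) 0 :=
      (((abelianU ℂ Z hZ y : Hil n →L[ℂ] Hil n).restrictScalars ℝ).hasFDerivAt.comp_hasDerivAt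
        (0 : ℝ) h0)
    simp only [← abelianU_add, zero_add] at h1
    exact h1
  refine ⟨fderiv ℝ (fun y => abelianU ℂ Z hZ y g) 0 (EuclideanSpace.single l (1 : ℝ)),
    ae_eq_of_hasLineDerivAt_abelianU hZ (hd 0), hd', ?_⟩
  have e : (fun y => abelianU ℂ Z hZ y (fderiv ℝ (fun y => abelianU ℂ Z hZ y g) 0
      (EuclideanSpace.single l (1 : ℝ)))) = fun y =>
      fderiv ℝ (fun y => abelianU ℂ Z hZ y g) y (EuclideanSpace.single l (1 : ℝ)) := by
    ext1 y
    exact (hd' y).unique (hd y)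
  rw [e]
  exact (hg.continuous_fderiv (by simp)).clm_apply continuous_const

/-! ### The momentum operator conjugated by the abelian group -/

/-- The derivative `∂_i Z` as a vector. -/
def partialZ (Z : Pos n → Pos n) (i : Fin n) (s : Pos n) : Pos n :=
  fderiv ℝ Z s (EuclideanSpace.single i (1 : ℝ))

variable {O : Set (Pos n)}

theorem hasLineDerivAt_of_mem (hO : IsOpen O) (hZO : ContDiffOn ℝ 1 Z O) (i : Fin n) {s : Pos n}
    (hs : s ∈ O) : HasLineDerivAt ℝ Z (partialZ Z i s) s (EuclideanSpace.single i (1 : ℝ)) :=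
  ((hZO.differentiableOn one_ne_zero).differentiableAt
    (hO.mem_nhds hs)).hasFDerivAt.hasLineDerivAt _

theorem lineDeriv_coord_eq (hO : IsOpen O) (hZO : ContDiffOn ℝ 1 Z O) (i k : Fin n) {s : Pos n}
    (hs : s ∈ O) :
    lineDeriv ℝ (fun t => Z t k) s (EuclideanSpace.single i (1 : ℝ)) = partialZ Z i s k := by
  have h : HasDerivAt (fun t : ℝ => Z (s + t • EuclideanSpace.single i (1 : ℝ)))
    (partialZ Z i s) 0 := hasLineDerivAt_of_mem hO hZO i hs
  have h2 : HasDerivAt (fun t : ℝ => Z (s + t • EuclideanSpace.single i (1 : ℝ)) k)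
    (partialZ Z i s k) 0 :=
    (EuclideanSpace.proj k : Pos n →L[ℝ] ℝ).hasFDerivAt.comp_hasDerivAt (0 : ℝ) h
  exact HasLineDerivAt.lineDeriv h2

theorem continuousOn_partialZ (hO : IsOpen O) (hZO : ContDiffOn ℝ 1 Z O) (i : Fin n) :
    ContinuousOn (partialZ Z i) O :=
  (hZO.continuousOn_fderiv_of_isOpen hO le_rfl).clm_apply continuousOn_const

theorem hasLineDerivAt_cexp_pairing (hO : IsOpen O) (hZO : ContDiffOn ℝ 1 Z O) (i : Fin n)
    (y : Pos n) {s : Pos n} (hs : s ∈ O) {f : Pos n → ℂ} {f' : ℂ}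
    (hf : HasLineDerivAt ℝ f f' s (EuclideanSpace.single i (1 : ℝ))) :
    HasLineDerivAt ℝ (fun t => cexp (I * (pairing y (Z t) : ℝ)) * f t)
      (cexp (I * (pairing y (Z s) : ℝ)) * (f' + I * (pairing y (partialZ Z i s) : ℝ) * f s)) s
      (EuclideanSpace.single i (1 : ℝ)) := by
  have h1 : HasDerivAt (fun t : ℝ => Z (s + t • EuclideanSpace.single i (1 : ℝ)))
    (partialZ Z i s) 0 := hasLineDerivAt_of_mem hO hZO i hs
  have h2 : HasDerivAt (fun t : ℝ => pairing y (Z (s + t • EuclideanSpace.single i (1 : ℝ))))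
      (pairing y (partialZ Z i s)) 0 := by
    simp only [pairing_eq_inner]
    exact (innerSL ℝ y).hasFDerivAt.comp_hasDerivAt (0 : ℝ) h1
  have h3 := ((h2.ofReal_comp.const_mul I).cexp).mul hf
  simp only [zero_smul, add_zero] at h3
  exact h3.congr_deriv (by ring)

theorem continuousOn_cexp_pairing (hZO : ContDiffOn ℝ 1 Z O) (y : Pos n) :
    ContinuousOn (fun s => cexp (I * (pairing y (Z s) : ℝ))) O := by
  have h : Continuous fun x : Pos n => cexp (I * (pairing y x : ℝ)) :=
    Complex.continuous_exp.comp (continuous_const.mul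
      (Complex.continuous_ofReal.comp (continuous_pairing continuous_const continuous_id)))
  exact h.comp_continuousOn hZO.continuousOn

theorem momentum_abelianU_ae_eq (hO : IsOpen O) (hOc : volume Oᶜ = 0) (hZO : ContDiffOn ℝ 1 Z O)
    (i : Fin n) (f : 𝓢(Pos n, ℂ)) (y : Pos n)
    (h : abelianU ℂ Z hZ y (f.toLp 2 volume) ∈ (momentum i).domain) :
    momentum i ⟨abelianU ℂ Z hZ y (f.toLp 2 volume), h⟩ =ᵐ[volume] fun s =>
      cexp (I * (pairing y (Z s) : ℝ)) *
        (I * (∂_{EuclideanSpace.single i (1 : ℝ)} f) s -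
          (pairing y (partialZ Z i s) : ℝ) * f s) := by
  have hφ : ((⟨abelianU ℂ Z hZ y (f.toLp 2 volume), h⟩ : (momentum i).domain) : Hil n)
      =ᵐ[volume] fun s => cexp (I * (pairing y (Z s) : ℝ)) * f s := by
    filter_upwards [coeFn_abelianU hZ y (f.toLp 2 volume),
      f.coeFn_toLp 2 (volume : Measure (Pos n))] with s h1 h2
    rw [h1, h2, smul_eq_mul]
  have hf : ∀ s, HasLineDerivAt ℝ f ((∂_{EuclideanSpace.single i (1 : ℝ)} f) s) s
      (EuclideanSpace.single i (1 : ℝ)) := fun s => by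
    rw [SchwartzMap.lineDerivOp_apply_eq_fderiv]
    exact (f.hasFDerivAt s).hasLineDerivAt _
  have hp : ContinuousOn (fun s => pairing y (partialZ Z i s)) O :=
    (continuous_pairing continuous_const continuous_id).comp_continuousOn
      (continuousOn_partialZ hO hZO i)
  have key := momentum_ae_eq_of_hasLineDerivAt i ⟨_, h⟩ hO hφ
    (fun s hs => hasLineDerivAt_cexp_pairing hO hZO i y hs (hf s))
    ((continuousOn_cexp_pairing hZO y).mul
      ((∂_{EuclideanSpace.single i (1 : ℝ)} f).continuous.continuousOn.add
        ((continuousOn_const.mul (Complex.continuous_ofReal.comp_continuousOn hp)).mul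
          f.continuous.continuousOn)))
  filter_upwards [key, compl_mem_ae_iff.2 hOc] with s h1 h2
  rw [h1 (not_not.1 h2)]
  linear_combination (cexp (I * (pairing y (Z s) : ℝ)) * (pairing y (partialZ Z i s) : ℝ) * f s) *
    I_mul_I

/-- On `𝓔` one has `P_i U(y) φ = U(y) (P_i φ - y_k ∂_i Z^k φ)`, all terms being smooth for `U`. -/
theorem exists_momentum_abelianU (hO : IsOpen O) (hOc : volume Oᶜ = 0)
    (hZO : ContDiffOn ℝ 1 Z O) {φ : Hil n} (hφ : φ ∈ smoothDomain Z hZ) (i : Fin n) :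
    ∃ (a : Hil n) (b : Fin n → Hil n),
      (∀ y, ∃ h : abelianU ℂ Z hZ y φ ∈ (momentum i).domain,
        momentum i ⟨abelianU ℂ Z hZ y φ, h⟩ = abelianU ℂ Z hZ y (a - ∑ k, (y k : ℂ) • b k)) ∧
      (∀ k, b k =ᵐ[volume] fun s => (partialZ Z i s k : ℂ) * φ s) ∧
      (ContDiff ℝ ∞ fun y => abelianU ℂ Z hZ y a) ∧
      ∀ k, ContDiff ℝ ∞ fun y => abelianU ℂ Z hZ y (b k) := by
  obtain ⟨⟨f, rfl⟩, -, hi⟩ := hφ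
  obtain ⟨hdom, hF⟩ := hi i
  have hae := fun y => momentum_abelianU_ae_eq hZ hO hOc hZO i f y (hdom y)
  set F : Pos n → Hil n := fun y => momentum i ⟨abelianU ℂ Z hZ y (f.toLp 2 volume), hdom y⟩
  let e : Fin n → Pos n := fun k => EuclideanSpace.single k (1 : ℝ)
  -- Since F(y) should equal U(y)(a - ∑ y_k b_k), comparing F(0) with U(-e_k) F(e_k) isolates b_k.
  -- Defined this way, b_k is in L² without any separate estimate on ∂_i Z.
  let b : Fin n → Hil n := fun k => F 0 - abelianU ℂ Z hZ (-e k) (F (e k))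
  have ha' : F 0 =ᵐ[volume] fun s => I * (∂_{EuclideanSpace.single i (1 : ℝ)} f) s := by
    filter_upwards [hae 0] with s hs
    rw [hs]
    simp [pairing]
  have hb' : ∀ k, b k =ᵐ[volume] fun s => (partialZ Z i s k : ℂ) * f s := by
    intro k
    filter_upwards [Lp.coeFn_sub (F 0) (abelianU ℂ Z hZ (-e k) (F (e k))),
      coeFn_abelianU hZ (-e k) (F (e k)), ha', hae (e k)] with s h1 h2 h3 h4
    rw [h1, Pi.sub_apply, h2, h3, h4, smul_eq_mul, ← mul_assoc,
      ← Complex.exp_add]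
    have : I * (pairing (-e k) (Z s) : ℝ) + I * (pairing (e k) (Z s) : ℝ) = 0 := by
      rw [← mul_add, ← Complex.ofReal_add, ← pairing_add_left]
      simp [pairing]
    rw [this, pairing_single_left]
    simp
  have hval : ∀ y, F y = abelianU ℂ Z hZ y (F 0 - ∑ k, (y k : ℂ) • b k) := by
    intro y
    ext1
    have hs' : ∀ᵐ s ∂(volume : Measure (Pos n)), ∀ k,
        ((y k : ℂ) • b k) s = (y k : ℂ) * (partialZ Z i s k : ℂ) * f s := by
      rw [ae_all_iff]
      intro k
      filter_upwards [Lp.coeFn_smul (y k : ℂ) (b k), hb' k] with s h1 h2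
      rw [h1, Pi.smul_apply, h2, smul_eq_mul, mul_assoc]
    filter_upwards [hae y, coeFn_abelianU hZ y (F 0 - ∑ k, (y k : ℂ) • b k),
      Lp.coeFn_sub (F 0) (∑ k, (y k : ℂ) • b k), ha', hs',
      Lp.coeFn_finsetSum Finset.univ fun k => (y k : ℂ) • b k] with s h1 h2 h3 h4 h5 h6
    rw [h1, h2, h3, Pi.sub_apply, h4, h6, Finset.sum_apply]
    simp only [h5, smul_eq_mul]
    rw [← Finset.sum_mul]
    simp [pairing]
  have hbU : ∀ k, ContDiff ℝ ∞ fun y => abelianU ℂ Z hZ y (b k) := by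
    intro k
    -- The same comparison at y - e_k and y expresses the orbit of b_k through F, whose smoothness
    -- is part of the definition of 𝓔.
    have h1 : (fun y => abelianU ℂ Z hZ y (b k)) =
        fun y => abelianU ℂ Z hZ (e k) (F (y - e k)) - F y := by
      ext1 y
      rw [hval (y - e k), ← abelianU_add, add_sub_cancel, hval y, ← map_sub]
      congr 1
      have h2 : ∀ j, ((y - e k) j : ℂ) • b j = (y j : ℂ) • b j - if j = k then b j else 0 := by
        intro j
        by_cases hj : j = k
        · simp [e, hj, sub_smul]
        · simp [e, hj]
      simp only [h2, Finset.sum_sub_distrib, Finset.sum_ite_eq', Finset.mem_univ, if_true]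
      abel
    rw [h1]
    exact (((abelianU ℂ Z hZ (e k) : Hil n →L[ℂ] Hil n).restrictScalars ℝ).contDiff.comp
      (hF.comp (contDiff_id.sub contDiff_const))).sub hF
  refine ⟨F 0, b, fun y => ⟨hdom y, hval y⟩, fun k => ?_, ?_, hbU⟩
  · filter_upwards [hb' k, f.coeFn_toLp 2 (volume : Measure (Pos n))] with s h1 h2
    rw [h1, h2]
  · have h1 : (fun y => abelianU ℂ Z hZ y (F 0)) =
        fun y => F y + ∑ k, y k • abelianU ℂ Z hZ y (b k) := by
      ext1 y
      have h2 : ∀ k, abelianU ℂ Z hZ y ((y k : ℂ) • b k) = y k • abelianU ℂ Z hZ y (b k) :=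
        fun k => map_smul _ _ _
      rw [hval y, map_sub, map_sum]
      simp only [h2]
      abel
    rw [h1]
    refine hF.add (ContDiff.sum fun k _ => ?_)
    exact (EuclideanSpace.proj k : Pos n →L[ℝ] ℝ).contDiff.smul (hbU k)

end Smooth

/-! ### Density of the smooth domain -/

section Density

variable {n : ℕ} {Z : Pos n → Pos n} (hZ : Measurable Z)

/-- The constant 3 serves both ranges: for |t| ≤ 1 the Taylor bound t² suffices, and for |t| > 1 the
trivial bound 2 + |t| is at most 3t². -/
theorem norm_cexp_sub_one_sub_le (t : ℝ) : ‖cexp (I * t) - 1 - I * t‖ ≤ 3 * t ^ 2 := by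
  rcases le_or_gt |t| 1 with h | h
  · have := Complex.norm_exp_sub_one_sub_id_le (x := I * t) (by simpa using h)
    have e : ‖I * (t : ℂ)‖ ^ 2 = t ^ 2 := by simp
    rw [e] at this
    nlinarith [sq_nonneg t]
  · have h1 : ‖cexp (I * t)‖ = 1 := by
      rw [mul_comm]
      exact Complex.norm_exp_ofReal_mul_I t
    have h2 : ‖I * (t : ℂ)‖ = |t| := by simp
    calc _ ≤ ‖cexp (I * t)‖ + ‖(1 : ℂ)‖ + ‖I * (t : ℂ)‖ :=
          (norm_sub_le _ _).trans (add_le_add_left (norm_sub_le _ _) _)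
      _ = 2 + |t| := by
          rw [h1, h2, norm_one]
          norm_num
      _ ≤ 3 * |t| ^ 2 := by nlinarith
      _ = 3 * t ^ 2 := by rw [sq_abs]

/-- On vectors supported where `Z` is bounded, multiplication by `Z_k` is everywhere defined. -/
theorem exists_mul_coord {Z : Pos n → Pos n} (hZ : Measurable Z) {R : ℝ} {h : Hil n}
    (hR : ∀ᵐ s, h s ≠ 0 → ‖Z s‖ ≤ R) (k : Fin n) :
    ∃ g : Hil n, (g =ᵐ[volume] fun s => (Z s k : ℂ) * h s) ∧ ∀ᵐ s, g s ≠ 0 → ‖Z s‖ ≤ R := by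
  have hm : Measurable fun s => Z s k :=
    (EuclideanSpace.proj k : Pos n →L[ℝ] ℝ).continuous.measurable.comp hZ
  have hL : MemLp (fun s => (Z s k : ℂ) * h s) 2 volume := by
    refine (Lp.memLp h).of_le_mul (c := R)
      ((Complex.continuous_ofReal.measurable.comp hm).aestronglyMeasurable.mul (Lp.memLp h).1) ?_
    filter_upwards [hR] with s hs
    rw [norm_mul, Complex.norm_real]
    by_cases h0 : h s = 0
    · simp [h0]
    · exact mul_le_mul_of_nonneg_right ((PiLp.norm_apply_le _ _).trans (hs h0)) (norm_nonneg _)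
  refine ⟨hL.toLp _, hL.coeFn_toLp, ?_⟩
  filter_upwards [hL.coeFn_toLp, hR] with s h1 h2 h3
  refine h2 fun h0 => h3 ?_
  rw [h1, h0, mul_zero]

/-- Where h ≠ 0 the phase satisfies |v·Z| ≤ R‖v‖, so the first-order remainder at 0 is quadratic in
v; unitarity of U(y) carries the estimate to every `y`. -/
theorem hasFDerivAt_abelianU_of_bounded {R : ℝ} {h : Hil n}
    (hR : ∀ᵐ s, h s ≠ 0 → ‖Z s‖ ≤ R) {g : Fin n → Hil n}
    (hg : ∀ k, g k =ᵐ[volume] fun s => (Z s k : ℂ) * h s) (y : Pos n) :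
    HasFDerivAt (fun y => abelianU ℂ Z hZ y h)
      (∑ k, (EuclideanSpace.proj k : Pos n →L[ℝ] ℝ).smulRight (I • abelianU ℂ Z hZ y (g k))) y := by
  have key : ∀ v : Pos n, ‖abelianU ℂ Z hZ v h - h - ∑ k, v k • I • g k‖ ≤
      3 * R ^ 2 * ‖v‖ ^ 2 * ‖h‖ := by
    intro v
    refine Lp.norm_le_mul_norm_of_ae_le_mul ?_
    have hs' : ∀ᵐ s ∂(volume : Measure (Pos n)), ∀ k,
        (v k • I • g k) s = I * (v k * Z s k : ℝ) * h s := by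
      rw [ae_all_iff]
      intro k
      filter_upwards [Lp.coeFn_smul (v k) (I • g k), Lp.coeFn_smul I (g k), hg k] with s h1 h2 h3
      rw [h1, Pi.smul_apply, h2, Pi.smul_apply, h3, Complex.real_smul, smul_eq_mul]
      push_cast
      ring
    filter_upwards [Lp.coeFn_sub (abelianU ℂ Z hZ v h - h) (∑ k, v k • I • g k),
      Lp.coeFn_sub (abelianU ℂ Z hZ v h) h, coeFn_abelianU hZ v h, hs',
      Lp.coeFn_finsetSum Finset.univ fun k => v k • I • g k, hR] with s h1 h2 h3 h4 h5 h6
    rw [h1, Pi.sub_apply, h2, Pi.sub_apply, h3, h5, Finset.sum_apply]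
    simp only [h4]
    rw [← Finset.sum_mul, ← Finset.mul_sum, ← Complex.ofReal_sum]
    change ‖cexp (I * (pairing v (Z s) : ℝ)) • h s - h s - I * (pairing v (Z s) : ℝ) * h s‖ ≤ _
    have e : cexp (I * (pairing v (Z s) : ℝ)) • h s - h s - I * (pairing v (Z s) : ℝ) * h s =
        (cexp (I * (pairing v (Z s) : ℝ)) - 1 - I * (pairing v (Z s) : ℝ)) * h s := by
      rw [smul_eq_mul]
      ring
    rw [e, norm_mul]
    by_cases h0 : h s = 0
    · simp [h0]
    refine mul_le_mul_of_nonneg_right ((norm_cexp_sub_one_sub_le _).trans ?_) (norm_nonneg _)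
    have h7 : |pairing v (Z s)| ≤ ‖v‖ * R :=
      (abs_pairing_le v (Z s)).trans (mul_le_mul_of_nonneg_left (h6 h0) (norm_nonneg v))
    have h8 : pairing v (Z s) ^ 2 ≤ (‖v‖ * R) ^ 2 := by
      rw [← sq_abs]
      gcongr
    nlinarith
  rw [hasFDerivAt_iff_isLittleO_nhds_zero]
  refine Asymptotics.IsBigO.trans_isLittleO (g := fun v : Pos n => ‖v‖ ^ 2) ?_ ?_
  · refine Asymptotics.IsBigO.of_bound (3 * R ^ 2 * ‖h‖) (Eventually.of_forall fun v => ?_)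
    have e : abelianU ℂ Z hZ (y + v) h - abelianU ℂ Z hZ y h -
        (∑ k, (EuclideanSpace.proj k : Pos n →L[ℝ] ℝ).smulRight
          (I • abelianU ℂ Z hZ y (g k))) v =
        abelianU ℂ Z hZ y (abelianU ℂ Z hZ v h - h - ∑ k, v k • I • g k) := by
      have e1 : ∀ k, abelianU ℂ Z hZ y (v k • I • g k) = v k • I • abelianU ℂ Z hZ y (g k) := by
        intro k
        have h1 := map_smul (abelianU ℂ Z hZ y) ((v k : ℂ) * I) (g k)
        rw [mul_smul, mul_smul] at h1
        exact h1
      rw [map_sub, map_sub, map_sum, abelianU_add]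
      simp only [e1, sum_apply, ContinuousLinearMap.smulRight_apply]
      rfl
    rw [e, LinearIsometryEquiv.norm_map]
    refine (key v).trans (le_of_eq ?_)
    rw [Real.norm_of_nonneg (by positivity)]
    ring
  · exact Asymptotics.isLittleO_norm_pow_id one_lt_two

/-- The derivative is built from the orbits of the vectors Z_k h, which satisfy the same boundedness
hypothesis with the same `R`; hence the induction. -/
theorem contDiff_abelianU_of_bounded {R : ℝ} {h : Hil n} (hR : ∀ᵐ s, h s ≠ 0 → ‖Z s‖ ≤ R) :
    ContDiff ℝ ∞ fun y => abelianU ℂ Z hZ y h := by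
  rw [contDiff_infty]
  intro N
  induction N generalizing h with
  | zero =>
    choose g hg _ using exists_mul_coord hZ hR
    exact contDiff_zero.2 (continuous_iff_continuousAt.2 fun y =>
      (hasFDerivAt_abelianU_of_bounded hZ hR hg y).continuousAt)
  | succ N ih =>
    choose g hg hgR using exists_mul_coord hZ hR
    refine contDiff_succ_iff_hasFDerivAt.2
      ⟨_, ?_, fun y => hasFDerivAt_abelianU_of_bounded hZ hR hg y⟩
    refine ContDiff.sum fun k _ => ?_
    exact contDiff_const.smulRight ((ih (hgR k)).const_smul I)

theorem contDiff_mul_of_tsupport_subset {E : Type*} [NormedAddCommGroup E] [NormedSpace ℝ E]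
    {O : Set E} (hO : IsOpen O) {N : ℕ∞ω} {f g : E → ℂ} (hg : ContDiffOn ℝ N g O)
    (hf : ContDiff ℝ N f) (hs : tsupport f ⊆ O) : ContDiff ℝ N fun s => g s * f s := by
  rw [contDiff_iff_contDiffAt]
  intro s
  by_cases h : s ∈ tsupport f
  · exact (hg.contDiffAt (hO.mem_nhds (hs h))).mul hf.contDiffAt
  · refine (contDiffAt_const (c := (0 : ℂ))).congr_of_eventuallyEq ?_
    filter_upwards [notMem_tsupport_iff_eventuallyEq.1 h] with t ht
    simp [ht]

variable {O : Set (Pos n)}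

theorem exists_bound_of_tsupport_subset (hZO : ContDiffOn ℝ 1 Z O) {f : Pos n → ℂ}
    (hc : HasCompactSupport f) (hs : tsupport f ⊆ O) : ∃ R, ∀ s ∈ tsupport f, ‖Z s‖ ≤ R := by
  obtain ⟨R, hR⟩ := hc.isCompact.exists_bound_of_continuousOn (hZO.continuousOn.mono hs)
  exact ⟨R, hR⟩

theorem toLp_mem_smoothDomain (hO : IsOpen O) (hZO : ContDiffOn ℝ 1 Z O) {f : Pos n → ℂ}
    (hc : HasCompactSupport f) (hf : ContDiff ℝ ∞ f) (hs : tsupport f ⊆ O) :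
    (hc.toSchwartzMap hf).toLp 2 volume ∈ smoothDomain Z hZ := by
  obtain ⟨R, hR⟩ := exists_bound_of_tsupport_subset hZO hc hs
  set φ : Hil n := (hc.toSchwartzMap hf).toLp 2 volume
  have hφ : φ =ᵐ[volume] f := (hc.toSchwartzMap hf).coeFn_toLp 2 volume
  have bdd : ∀ {g : Hil n} {g0 : Pos n → ℂ}, g =ᵐ[volume] g0 →
      (∀ s, s ∉ tsupport f → g0 s = 0) → ∀ᵐ s, g s ≠ 0 → ‖Z s‖ ≤ R := by
    intro g g0 hg h0
    filter_upwards [hg] with s h1 h2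
    by_contra h3
    exact h2 (h1.trans (h0 s fun h4 => h3 (hR s h4)))
  have hφU : ContDiff ℝ ∞ fun y => abelianU ℂ Z hZ y φ :=
    contDiff_abelianU_of_bounded hZ (bdd hφ fun s h => image_eq_zero_of_notMem_tsupport h)
  refine ⟨⟨_, rfl⟩, hφU, fun i => ?_⟩
  set e : Pos n := EuclideanSpace.single i (1 : ℝ)
  have hf1 : ContDiff ℝ 1 f := hf.of_le (by norm_num)
  have hdf : ∀ s, HasLineDerivAt ℝ f (fderiv ℝ f s e) s e := fun s =>
    (hf1.differentiable one_ne_zero s).hasFDerivAt.hasLineDerivAt _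
  have hf'c : Continuous fun s => fderiv ℝ f s e :=
    (hf1.continuous_fderiv one_ne_zero).clm_apply continuous_const
  have hf's : HasCompactSupport fun s => fderiv ℝ f s e := hc.fderiv_apply ℝ _
  have hf'0 : ∀ s, s ∉ tsupport f → fderiv ℝ f s e = 0 := fun s h => by
    have := image_eq_zero_of_notMem_tsupport (fun h' => h (tsupport_fderiv_subset ℝ h'))
    rw [this]
    rfl
  have ha : MemLp (fun s => fderiv ℝ f s e) 2 (volume : Measure (Pos n)) :=
    hf'c.memLp_of_hasCompactSupport hf's
  have hbc : ∀ k, Continuous fun s => (partialZ Z i s k : ℂ) * f s := fun k => by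
    rw [← contDiff_zero (𝕜 := ℝ)]
    refine contDiff_mul_of_tsupport_subset hO (contDiffOn_zero.2 ?_) (contDiff_zero.2 hf.continuous)
      hs
    exact (Complex.continuous_ofReal.comp
      (EuclideanSpace.proj k : Pos n →L[ℝ] ℝ).continuous).comp_continuousOn
        (continuousOn_partialZ hO hZO i)
  have hb : ∀ k, MemLp (fun s => (partialZ Z i s k : ℂ) * f s) 2 (volume : Measure (Pos n)) :=
    fun k => (hbc k).memLp_of_hasCompactSupport hc.mul_left
  let a : Hil n := ha.toLp _
  let b : Fin n → Hil n := fun k => (hb k).toLp _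
  have haU : ContDiff ℝ ∞ fun y => abelianU ℂ Z hZ y a :=
    contDiff_abelianU_of_bounded hZ (bdd ha.coeFn_toLp hf'0)
  have hbU : ∀ k, ContDiff ℝ ∞ fun y => abelianU ℂ Z hZ y (b k) := fun k =>
    contDiff_abelianU_of_bounded hZ (bdd (hb k).coeFn_toLp fun s h => by
      rw [image_eq_zero_of_notMem_tsupport h, mul_zero])
  have hval : ∀ y, ∃ h : abelianU ℂ Z hZ y φ ∈ (momentum i).domain,
      momentum i ⟨_, h⟩ = I • (abelianU ℂ Z hZ y a + I • ∑ k, y k • abelianU ℂ Z hZ y (b k)) := by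
    intro y
    have hexp : ContDiffOn ℝ 1 (fun s => cexp (I * (pairing y (Z s) : ℝ))) O := by
      simp only [pairing_eq_inner]
      have h1 : ContDiffOn ℝ 1 (fun s => inner ℝ y (Z s)) O := contDiffOn_const.inner ℝ hZO
      exact (contDiffOn_const.mul (Complex.ofRealCLM.contDiff.comp_contDiffOn h1)).cexp
    -- Z is only C¹, so U(y)φ need not be a Schwartz function; membership in the domain of P_i comes
    -- from mollification.
    refine exists_momentum_of_contDiff i (contDiff_mul_of_tsupport_subset hO hexp hf1 hs)
      hc.mul_left ?_ ?_
    · filter_upwards [coeFn_abelianU hZ y φ, hφ] with s h1 h2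
      rw [h1, h2, smul_eq_mul]
    · have hs' : ∀ᵐ s ∂(volume : Measure (Pos n)), ∀ k, (y k • abelianU ℂ Z hZ y (b k)) s =
          cexp (I * (pairing y (Z s) : ℝ)) * ((y k * partialZ Z i s k : ℝ) * f s) := by
        rw [ae_all_iff]
        intro k
        filter_upwards [Lp.coeFn_smul (y k) (abelianU ℂ Z hZ y (b k)),
          coeFn_abelianU hZ y (b k), (hb k).coeFn_toLp] with s h1 h2 h3
        rw [h1, Pi.smul_apply, h2, h3, Complex.real_smul, smul_eq_mul]
        push_cast
        ring
      filter_upwards [Lp.coeFn_add (abelianU ℂ Z hZ y a) (I • ∑ k, y k • abelianU ℂ Z hZ y (b k)),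
        Lp.coeFn_smul I (∑ k, y k • abelianU ℂ Z hZ y (b k)), hs',
        Lp.coeFn_finsetSum Finset.univ fun k => y k • abelianU ℂ Z hZ y (b k),
        coeFn_abelianU hZ y a, ha.coeFn_toLp] with s h1 h2 h3 h4 h5 h6
      rw [h1, Pi.add_apply, h2, Pi.smul_apply, h4, Finset.sum_apply, h5, h6]
      simp only [h3, smul_eq_mul]
      rw [← Finset.mul_sum, ← Finset.sum_mul, ← Complex.ofReal_sum]
      change cexp (I * (pairing y (Z s) : ℝ)) * fderiv ℝ f s e +
        I * (cexp (I * (pairing y (Z s) : ℝ)) * ((pairing y (partialZ Z i s) : ℝ) * f s)) = _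
      have hd : DifferentiableAt ℝ (fun s => cexp (I * (pairing y (Z s) : ℝ)) * f s) s :=
        (contDiff_mul_of_tsupport_subset hO hexp hf1 hs).differentiable one_ne_zero s
      by_cases hmem : s ∈ O
      · have h7 := hasLineDerivAt_cexp_pairing hO hZO i y hmem (hdf s)
        rw [(hd.hasFDerivAt.hasLineDerivAt e).unique h7]
        ring
      · have h8 : s ∉ tsupport f := fun h => hmem (hs h)
        have h9 : (fun s => cexp (I * (pairing y (Z s) : ℝ)) * f s) =ᶠ[𝓝 s] fun _ => 0 := by
          filter_upwards [notMem_tsupport_iff_eventuallyEq.1 h8] with t ht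
          simp [ht]
        rw [h9.fderiv_eq, hf'0 s h8, image_eq_zero_of_notMem_tsupport h8]
        simp
  refine ⟨fun y => (hval y).1, ?_⟩
  have e2 : (fun y => momentum i ⟨abelianU ℂ Z hZ y φ, (hval y).1⟩) = fun y =>
      I • (abelianU ℂ Z hZ y a + I • ∑ k, y k • abelianU ℂ Z hZ y (b k)) :=
    funext fun y => (hval y).2
  rw [e2]
  refine (haU.add ((ContDiff.sum fun k _ => ?_).const_smul I)).const_smul I
  exact (EuclideanSpace.proj k : Pos n →L[ℝ] ℝ).contDiff.smul (hbU k)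

/-- A vector orthogonal to all g ⊗ e_a, with g a test function supported in `O`, has components
vanishing almost everywhere on `O`, which has full measure. -/
theorem dense_tensorDomain_smoothDomain (m : ℕ) (hO : IsOpen O) (hOc : volume Oᶜ = 0)
    (hZO : ContDiffOn ℝ 1 Z O) :
    Dense (tensorDomain m (smoothDomain Z hZ) : Set (HilT n m)) := by
  rw [Submodule.dense_iff_topologicalClosure_eq_top, Submodule.topologicalClosure_eq_top_iff,
    Submodule.eq_bot_iff]
  intro Φ hΦ
  have hcomp : ∀ a : Fin m, component a Φ = 0 := by
    intro a
    have key : ∀ᵐ s ∂(volume : Measure (Pos n)), s ∈ O → component a Φ s = 0 := by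
      refine hO.ae_eq_zero_of_integral_contDiff_smul_eq_zero
        (((Lp.memLp (component a Φ)).locallyIntegrable (by norm_num)).locallyIntegrableOn O) ?_
      intro g hg hgc hgs
      have hc : HasCompactSupport fun s => (g s : ℂ) :=
        hgc.comp_left (g := ((↑) : ℝ → ℂ)) Complex.ofReal_zero
      have hs : ContDiff ℝ ∞ fun s => (g s : ℂ) := Complex.ofRealCLM.contDiff.comp hg
      have ht : tsupport (fun s => (g s : ℂ)) ⊆ O := by
        refine (closure_mono ?_).trans hgs
        intro s h h0
        exact h (by simp [h0])
      have hmem := toLp_mem_smoothDomain hZ hO hZO hc hs ht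
      have h0 := hΦ _ (tensorVec_mem_tensorDomain hmem (EuclideanSpace.single a (1 : ℂ)))
      rw [L2.inner_def] at h0
      rw [← h0]
      apply integral_congr_ae
      filter_upwards [coeFn_component a Φ, coeFn_tensorVec (EuclideanSpace.single a (1 : ℂ))
        ((hc.toSchwartzMap hs).toLp 2 volume),
        (hc.toSchwartzMap hs).coeFn_toLp 2 (volume : Measure (Pos n))] with s h1 h2 h3
      rw [h1, h2, h3, inner_smul_left, EuclideanSpace.inner_single_left]
      simp
    ext1
    filter_upwards [key, compl_mem_ae_iff.2 hOc,
      Lp.coeFn_zero ℂ 2 (volume : Measure (Pos n))] with s h1 h2 h3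
    rw [h1 (not_not.1 h2), h3]
    rfl
  rw [← sum_tensorBasis_component Φ]
  simp [hcomp]

end Density

/-! ### The deformed momentum operators -/

section Deformed

variable {n m : ℕ} {Z : Pos n → Pos n} (hZ : Measurable Z)

theorem abelianU_sum_tensorVec {ι : Type*} (t : Finset ι) (v : ι → Fib m) (f : ι → Hil n)
    (y : Pos n) : abelianU (Fib m) Z hZ y (∑ j ∈ t, tensorVec (v j) (f j)) =
      ∑ j ∈ t, tensorVec (v j) (abelianU ℂ Z hZ y (f j)) := by
  rw [map_sum]
  exact Finset.sum_congr rfl fun j _ => abelianU_tensorVec hZ y (v j) (f j)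

/-- U(cp) P_i U(-cp) U(y)φ = U(cp) P_i U(y - cp)φ, and the affine formula applies at y - cp. The
left deformation uses y = 0, the right one all `y`. -/
theorem adjointAction_momentum_mem_graph {N : Matrix (Fin m) (Fin m) ℂ} (hN : N.IsHermitian)
    {v : Fib m} {c : ℝ} (hv : Matrix.toEuclideanCLM (𝕜 := ℂ) N v = (c : ℂ) • v) {i : Fin n}
    {φ a : Hil n} {b : Fin n → Hil n}
    (hab : ∀ y, ∃ h : abelianU ℂ Z hZ y φ ∈ (momentum i).domain,
        momentum i ⟨abelianU ℂ Z hZ y φ, h⟩ = abelianU ℂ Z hZ y (a - ∑ k, (y k : ℂ) • b k))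
    (p y : Pos n) :
    (tensorVec v (abelianU ℂ Z hZ y φ),
      tensorVec v (abelianU ℂ Z hZ y (a - ∑ k, ((y - c • p) k : ℂ) • b k))) ∈
      (adjointAction Z hZ N hN p (momentum i)).graph := by
  have e : abelianU ℂ Z hZ (-(c • p)) (abelianU ℂ Z hZ y φ) = abelianU ℂ Z hZ (y - c • p) φ := by
    rw [← abelianU_add, neg_add_eq_sub]
  obtain ⟨h, hval⟩ := hab (y - c • p)
  have h' : abelianU ℂ Z hZ (-(c • p)) (abelianU ℂ Z hZ y φ) ∈ (momentum i).domain := by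
    rwa [e]
  obtain ⟨hd, hA⟩ := adjointAction_tensorVec hZ hN hv p (momentum i) (abelianU ℂ Z hZ y φ) h'
  refine (LinearPMap.mem_graph_iff _).2 ⟨⟨_, hd⟩, rfl, hA.trans ?_⟩
  have e2 : momentum i ⟨_, h'⟩ = momentum i ⟨_, h⟩ := congrArg (momentum i) (Subtype.ext e)
  rw [e2, hval, ← abelianU_add, add_sub_cancel]

variable {O : Set (Pos n)}

/-- Since d_kl = i Z_l b_k, the vector -i d_kl is Z_l (∂_i Z^k) φ, and summing against Θ_kl gives
the gauge factor; the eigenvalue c is the action of the matrix on v. The L² vectors d_kl also show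
that the gauge term is defined on φ ⊗ v. -/
theorem minimalMomentum_mem_graph (hO : IsOpen O) (hOc : volume Oᶜ = 0) (hZO : ContDiffOn ℝ 1 Z O)
    {q : ℝ} (hq : q ≠ 0) (Θ : Matrix (Fin n) (Fin n) ℝ)
    (Y τ : Fin (m ^ 2 - 1) → Matrix (Fin m) (Fin m) ℂ)
    {v : Fib m} {c : ℝ}
    (hv : Matrix.toEuclideanCLM (𝕜 := ℂ) (∑ α, Y α * τ α) v = (c : ℂ) • v) {i : Fin n}
    {φ a : Hil n} {b : Fin n → Hil n} {d : Fin n → Fin n → Hil n}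
    (ha : ∃ h : φ ∈ (momentum i).domain, momentum i ⟨φ, h⟩ = a)
    (hb : ∀ k, b k =ᵐ[volume] fun s => (partialZ Z i s k : ℂ) * φ s)
    (hd : ∀ k l, d k l =ᵐ[volume] fun s => I * Z s l * b k s) :
    (tensorVec v φ, tensorVec v (a + (c : ℂ) • ∑ k, ∑ l, (Θ k l : ℂ) • -(I • d k l))) ∈
      (minimalMomentum q Z Θ Y τ i).graph := by
  obtain ⟨hφ, hPφ⟩ := ha
  set G : Hil n := (c : ℂ) • ∑ k, ∑ l, (Θ k l : ℂ) • -(I • d k l) with hG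
  have hGae : G =ᵐ[volume] fun s => (c : ℂ) * (gaugeFactor Z Θ i s : ℂ) * φ s := by
    have h1 : ∀ᵐ s ∂(volume : Measure (Pos n)), ∀ k l,
        ((Θ k l : ℂ) • -(I • d k l)) s =
          ((Θ k l * Z s l * partialZ Z i s k : ℝ) : ℂ) * φ s := by
      rw [ae_all_iff]
      intro k
      rw [ae_all_iff]
      intro l
      filter_upwards [Lp.coeFn_smul (Θ k l : ℂ) (-(I • d k l)), Lp.coeFn_neg (I • d k l),
        Lp.coeFn_smul I (d k l), hd k l, hb k] with s h1 h2 h3 h4 h5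
      rw [h1, Pi.smul_apply, h2, Pi.neg_apply, h3, Pi.smul_apply, h4, h5, smul_eq_mul, smul_eq_mul]
      push_cast
      linear_combination (-(Θ k l : ℂ) * Z s l * partialZ Z i s k * φ s) * I_mul_I
    have h2 : ∀ᵐ s ∂(volume : Measure (Pos n)), ∀ k,
        (∑ l, (Θ k l : ℂ) • -(I • d k l) : Hil n) s =
          ∑ l, ((Θ k l : ℂ) • -(I • d k l)) s := by
      rw [ae_all_iff]
      intro k
      filter_upwards [Lp.coeFn_finsetSum Finset.univ fun l => (Θ k l : ℂ) • -(I • d k l)]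
        with s hs
      rw [hs, Finset.sum_apply]
    filter_upwards [Lp.coeFn_smul (c : ℂ) (∑ k, ∑ l, (Θ k l : ℂ) • -(I • d k l)),
      Lp.coeFn_finsetSum Finset.univ fun k => ∑ l, (Θ k l : ℂ) • -(I • d k l), h1, h2,
      compl_mem_ae_iff.2 hOc] with s h3 h4 h5 h6 h7
    rw [hG, h3, Pi.smul_apply, h4, Finset.sum_apply]
    simp only [h6, h5]
    simp only [← Finset.sum_mul, ← Complex.ofReal_sum]
    rw [smul_eq_mul, ← mul_assoc]
    congr 3
    unfold gaugeFactor
    refine Finset.sum_congr rfl fun k _ => ?_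
    have e : (Θ.toEuclideanLin (Z s)) k = ∑ l, Θ k l * Z s l := rfl
    rw [lineDeriv_coord_eq hO hZO i k (not_not.1 h7), e, Finset.sum_mul]
  have hT : ∀ s, ∑ α, gaugeField q Z Θ Y i α s * τ α =
      ((-(gaugeFactor Z Θ i s) / q : ℝ) : ℂ) • ∑ α, Y α * τ α := by
    intro s
    rw [Finset.smul_sum]
    exact Finset.sum_congr rfl fun α _ => Matrix.smul_mul _ _ _
  have hmul : (fun s => Matrix.toEuclideanCLM (𝕜 := ℂ) (∑ α, gaugeField q Z Θ Y i α s * τ α)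
      (tensorVec v φ s)) =ᵐ[volume] ((-(q : ℂ)⁻¹) • tensorVec v G : HilT n m) := by
    filter_upwards [Lp.coeFn_smul (-(q : ℂ)⁻¹) (tensorVec v G : HilT n m), coeFn_tensorVec v G,
      coeFn_tensorVec v φ, hGae] with s h1 h2 h3 h4
    rw [h1, Pi.smul_apply, h2, h3, h4, hT, map_smul, map_smul, smul_apply, hv]
    simp only [smul_smul]
    congr 1
    push_cast
    ring
  have hdom : tensorVec v φ ∈
      (matrixMul (fun s => ∑ α, gaugeField q Z Θ Y i α s * τ α) :
        HilT n m →ₗ.[ℂ] HilT n m).domain :=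
    (memLp_congr_ae hmul).2 (Lp.memLp _)
  have hval : matrixMul (fun s => ∑ α, gaugeField q Z Θ Y i α s * τ α) ⟨tensorVec v φ, hdom⟩ =
      (-(q : ℂ)⁻¹) • tensorVec v G := by
    ext1
    exact (memLp_of_mem_matrixMulDomain hdom).coeFn_toLp.trans hmul
  have hamp : tensorVec v φ ∈ (ampliation m (momentum i)).domain :=
    tensorVec_mem_tensorDomain hφ v
  refine (LinearPMap.mem_graph_iff _).2 ⟨⟨tensorVec v φ, hamp, hdom⟩, rfl, ?_⟩
  change ampliation m (momentum i) ⟨tensorVec v φ, hamp⟩ -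
    (q : ℂ) • matrixMul (fun s => ∑ α, gaugeField q Z Θ Y i α s * τ α) ⟨tensorVec v φ, hdom⟩ = _
  have h1 := ampliation_tensorVec (momentum i) v ⟨φ, hφ⟩ hamp
  have hqc : (q : ℂ) ≠ 0 := by exact_mod_cast hq
  rw [hval, smul_smul, mul_neg, mul_inv_cancel₀ hqc, neg_one_smul, sub_neg_eq_add, map_add,
    ← hPφ]
  exact congrArg (· + tensorVec v G) h1

/-- The scalar oscillatory integral behind the left deformation. -/
theorem hasOscillatoryIntegral_left {a : Hil n} {b : Fin n → Hil n} {d : Fin n → Fin n → Hil n}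
    (ha : Continuous fun y => abelianU ℂ Z hZ y a)
    (hb : ∀ k, Continuous fun y => abelianU ℂ Z hZ y (b k))
    (hd : ∀ k l, Continuous fun y => abelianU ℂ Z hZ y (d k l))
    (hbd : ∀ k l y, HasLineDerivAt ℝ (fun y => abelianU ℂ Z hZ y (b k))
      (abelianU ℂ Z hZ y (d k l)) y (EuclideanSpace.single l (1 : ℝ)))
    (Θ : Matrix (Fin n) (Fin n) ℝ) (c : ℝ) :
    HasOscillatoryIntegral
      (fun x y => abelianU ℂ Z hZ y (a + ∑ k, ((c • Θ.toEuclideanLin x) k : ℂ) • b k))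
      (a + (c : ℂ) • ∑ k, ∑ l, (Θ k l : ℂ) • -(I • d k l)) := by
  have h1 := hasOscillatoryIntegral_snd ha (M := ‖a‖) fun y => (LinearIsometryEquiv.norm_map _ _).le
  have h2 := fun k l => hasOscillatoryIntegral_fst_smul (hb k) (M := ‖b k‖)
    (fun y => (LinearIsometryEquiv.norm_map _ _).le) (hd k l) (M' := ‖d k l‖)
    (fun y => (LinearIsometryEquiv.norm_map _ _).le) l (hbd k l)
  have h3 := h1.add ((HasOscillatoryIntegral.sum Finset.univ fun k _ =>
    HasOscillatoryIntegral.sum Finset.univ fun l _ => (h2 k l).const_smul (Θ k l : ℂ)).const_smul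
      (c : ℂ))
  simp only [abelianU_zero] at h3
  convert h3 using 3 with x y
  rw [map_add, map_sum, Finset.smul_sum]
  congr 1
  refine Finset.sum_congr rfl fun k _ => ?_
  rw [map_smul, Finset.smul_sum]
  simp only [smul_smul, ← Finset.sum_smul]
  congr 1
  have e : (c • Θ.toEuclideanLin x) k = c * ∑ l, Θ k l * x l := rfl
  rw [e, ← Finset.mul_sum]
  push_cast
  simp only [Finset.mul_sum]

theorem hasOscillatoryIntegral_right {a : Hil n} {b : Fin n → Hil n}
    {d : Fin n → Fin n → Hil n}
    (ha : Continuous fun y => abelianU ℂ Z hZ y a)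
    (hb : ∀ k, Continuous fun y => abelianU ℂ Z hZ y (b k))
    (hd : ∀ k l, Continuous fun y => abelianU ℂ Z hZ y (d k l))
    (hbd : ∀ k l y, HasLineDerivAt ℝ (fun y => abelianU ℂ Z hZ y (b k))
      (abelianU ℂ Z hZ y (d k l)) y (EuclideanSpace.single l (1 : ℝ)))
    (Θ : Matrix (Fin n) (Fin n) ℝ) (c : ℝ) :
    HasOscillatoryIntegral
      (fun x y => abelianU ℂ Z hZ y (a - ∑ k, ((y - c • Θ.toEuclideanLin x) k : ℂ) • b k))
      (a + (c : ℂ) • ∑ k, ∑ l, (Θ k l : ℂ) • -(I • d k l)) := by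
  have h1 := hasOscillatoryIntegral_left hZ ha hb hd hbd Θ c
  -- The right integrand differs from the left one by -∑ y_k U(y) b_k, whose oscillatory integral is
  -- zero.
  have h2 := (HasOscillatoryIntegral.sum Finset.univ fun k _ =>
    hasOscillatoryIntegral_snd_smul (hb k) (M := ‖b k‖)
    (fun y => (LinearIsometryEquiv.norm_map _ _).le) k).const_smul (-1)
  have h3 := h1.add h2
  simp only [Finset.sum_const_zero, smul_zero, add_zero] at h3
  convert h3 using 3 with x y
  have e : ∀ k, (((y - c • Θ.toEuclideanLin x) k : ℝ) : ℂ) • b k =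
      (y k : ℂ) • b k - ((c • Θ.toEuclideanLin x) k : ℂ) • b k := by
    intro k
    rw [PiLp.sub_apply, Complex.ofReal_sub, sub_smul]
  have e2 : ∑ k, (y k : ℂ) • abelianU ℂ Z hZ y (b k) =
      abelianU ℂ Z hZ y (∑ k, (y k : ℂ) • b k) := by
    rw [map_sum]
    exact Finset.sum_congr rfl fun k _ => (map_smul _ _ _).symm
  rw [Finset.sum_congr rfl fun k _ => e k, Finset.sum_sub_distrib, e2, neg_one_smul,
    ← sub_eq_add_neg, ← map_sub]
  congr 1
  abel

theorem HasOscillatoryIntegral.sum_tensorVec {ι : Type*} (t : Finset ι) (v : ι → Fib m)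
    {b : ι → Pos n → Pos n → Hil n} {w : ι → Hil n} (h : ∀ j, HasOscillatoryIntegral (b j) (w j)) :
    HasOscillatoryIntegral (fun x y => ∑ j ∈ t, tensorVec (v j) (b j x y))
      (∑ j ∈ t, tensorVec (v j) (w j) : HilT n m) :=
  HasOscillatoryIntegral.sum t fun j _ => (h j).clm_apply (tensorVec (v j))

theorem deformed_momentum_eq (hO : IsOpen O) (hOc : volume Oᶜ = 0) (hZO : ContDiffOn ℝ 1 Z O)
    {q : ℝ} (hq : q ≠ 0) (Θ : Matrix (Fin n) (Fin n) ℝ)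
    (Y τ : Fin (m ^ 2 - 1) → Matrix (Fin m) (Fin m) ℂ) (hY : (∑ α, Y α * τ α).IsHermitian)
    (i : Fin n) {Φ : HilT n m} (hΦ : Φ ∈ tensorDomain m (smoothDomain Z hZ)) :
    ∃ h : Φ ∈ (minimalMomentum q Z Θ Y τ i).domain,
      IsLeftWarped Z hZ (∑ α, Y α * τ α) hY Θ (momentum i) Φ
        (minimalMomentum q Z Θ Y τ i ⟨Φ, h⟩) ∧
      IsRightWarped Z hZ (∑ α, Y α * τ α) hY Θ (momentum i) Φ
        (minimalMomentum q Z Θ Y τ i ⟨Φ, h⟩) := by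
  set v := hY.eigenvectorBasis
  set c := hY.eigenvalues
  have hev : ∀ j, Matrix.toEuclideanCLM (𝕜 := ℂ) (∑ α, Y α * τ α) (v j) = (c j : ℂ) • v j := by
    intro j
    have h := hY.mulVec_eigenvectorBasis j
    ext k
    exact congrFun h k
  obtain ⟨φ, hφ, rfl⟩ := exists_eq_sum_tensorVec hΦ v
  choose a b hab hb haU hbU using fun j => exists_momentum_abelianU hZ hO hOc hZO (hφ j) i
  choose d hd hbd hdU using fun j k l => exists_lineDeriv_abelianU hZ (hbU j k) l
  have ha : ∀ j, ∃ h : φ j ∈ (momentum i).domain, momentum i ⟨φ j, h⟩ = a j := by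
    intro j
    obtain ⟨h, hval⟩ := hab j 0
    have h' : φ j ∈ (momentum i).domain := by
      rwa [abelianU_zero] at h
    refine ⟨h', ?_⟩
    have e : momentum i ⟨φ j, h'⟩ = momentum i ⟨_, h⟩ :=
      congrArg (momentum i) (Subtype.ext (abelianU_zero hZ (φ j)).symm)
    rw [e, hval, abelianU_zero]
    simp
  -- Graphs are submodules, so domain membership and value are summed over the eigenbasis together.
  have hgraph := Submodule.sum_mem _ fun j (_ : j ∈ Finset.univ) =>
    minimalMomentum_mem_graph hO hOc hZO hq Θ Y τ (hev j) (ha j) (hb j) (hd j)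
  rw [← prod_mk_sum, LinearPMap.mem_graph_iff] at hgraph
  obtain ⟨⟨Φ, hΦd⟩, hΦe, hW⟩ := hgraph
  simp only at hΦe
  subst hΦe
  refine ⟨hΦd, ?_⟩
  rw [hW]
  have hadj : ∀ p y, (∑ j, tensorVec (v j) (abelianU ℂ Z hZ y (φ j)),
      ∑ j, tensorVec (v j) (abelianU ℂ Z hZ y
        (a j - ∑ k, ((y - c j • p) k : ℂ) • b j k))) ∈
      (adjointAction Z hZ _ hY p (momentum i)).graph := by
    intro p y
    rw [prod_mk_sum]
    exact Submodule.sum_mem _ fun j _ =>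
      adjointAction_momentum_mem_graph hZ hY (hev j) (hab j) p y
  constructor
  · have hA : ∀ x : Pos n, ∃ h : ∑ j, tensorVec (v j) (φ j) ∈
        (adjointAction Z hZ _ hY (Θ.toEuclideanLin x) (momentum i)).domain,
        adjointAction Z hZ _ hY (Θ.toEuclideanLin x) (momentum i) ⟨_, h⟩ =
          ∑ j, tensorVec (v j) (a j + ∑ k, ((c j • Θ.toEuclideanLin x) k : ℂ) • b j k) := by
      intro x
      -- With y = 0 the coefficient is -(0 - c Θx)_k, which explains the plus sign in the left
      -- integrand.
      have h := hadj (Θ.toEuclideanLin x) 0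
      rw [LinearPMap.mem_graph_iff] at h
      obtain ⟨⟨Φ, h1⟩, h2, h3⟩ := h
      simp only [abelianU_zero] at h2 h3
      subst h2
      refine ⟨h1, h3.trans (Finset.sum_congr rfl fun j _ => ?_)⟩
      simp [sub_eq_add_neg]
    refine ⟨fun x => (hA x).1, ?_⟩
    convert HasOscillatoryIntegral.sum_tensorVec Finset.univ v fun j =>
      hasOscillatoryIntegral_left hZ (haU j).continuous (fun k => (hbU j k).continuous)
        (hdU j) (fun k l y => hbd j k l y) Θ (c j) using 3 with x y
    rw [(hA x).2, abelianU_sum_tensorVec]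
  · have hA : ∀ x y : Pos n, ∃ h : abelianU (Fib m) Z hZ y (∑ j, tensorVec (v j) (φ j)) ∈
        (adjointAction Z hZ _ hY (Θ.toEuclideanLin x) (momentum i)).domain,
        adjointAction Z hZ _ hY (Θ.toEuclideanLin x) (momentum i) ⟨_, h⟩ =
          ∑ j, tensorVec (v j) (abelianU ℂ Z hZ y
            (a j - ∑ k, ((y - c j • Θ.toEuclideanLin x) k : ℂ) • b j k)) := by
      intro x y
      have h := hadj (Θ.toEuclideanLin x) y
      rw [← abelianU_sum_tensorVec, LinearPMap.mem_graph_iff] at h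
      obtain ⟨⟨Φ, h1⟩, h2, h3⟩ := h
      simp only at h2 h3
      subst h2
      exact ⟨h1, h3⟩
    refine ⟨fun x y => (hA x y).1, ?_⟩
    convert HasOscillatoryIntegral.sum_tensorVec Finset.univ v fun j =>
      hasOscillatoryIntegral_right hZ (haU j).continuous (fun k => (hbU j k).continuous)
        (hdU j) (fun k l y => hbd j k l y) Θ (c j) using 3 with x y
    exact (hA x y).2

end Deformed

end NAWarped

end

theorem mainTheorem1 {n m : ℕ}
    (τ : Fin (m ^ 2 - 1) → Matrix (Fin m) (Fin m) ℂ) (hτ : NAWarped.IsSUGenerators τ)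
    (Y : Fin (m ^ 2 - 1) → Matrix (Fin m) (Fin m) ℂ) (hY : (∑ α, Y α * τ α).IsHermitian)
    (Z : NAWarped.Pos n → NAWarped.Pos n) (hZ : Measurable Z)
    (O : Set (NAWarped.Pos n)) (hO : IsOpen O) (hOc : volume Oᶜ = 0)
    (hZO : ContDiffOn ℝ 1 Z O)
    (Θ : Matrix (Fin n) (Fin n) ℝ) (hΘ : Θᵀ = -Θ) (q : ℝ) (hq : q ≠ 0) :
    Dense (NAWarped.tensorDomain m (NAWarped.smoothDomain Z hZ) : Set (NAWarped.HilT n m)) ∧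
    ∀ i : Fin n,
      (∀ α s, -(q : ℂ) • NAWarped.gaugeField q Z Θ Y i α s =
        ((∑ k, (Θ.toEuclideanLin (Z s)) k *
          lineDeriv ℝ (fun t => Z t k) s (EuclideanSpace.single i (1 : ℝ)) : ℝ) : ℂ) • Y α) ∧
      ∀ Φ ∈ NAWarped.tensorDomain m (NAWarped.smoothDomain Z hZ),
        ∃ h : Φ ∈ (NAWarped.minimalMomentum q Z Θ Y τ i).domain,
          ∀ Ψ : NAWarped.HilT n m,
            (NAWarped.IsLeftWarped Z hZ (∑ α, Y α * τ α) hY Θ (NAWarped.momentum i) Φ Ψ ↔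
              Ψ = NAWarped.minimalMomentum q Z Θ Y τ i ⟨Φ, h⟩) ∧
            (NAWarped.IsRightWarped Z hZ (∑ α, Y α * τ α) hY Θ (NAWarped.momentum i) Φ Ψ ↔
              Ψ = NAWarped.minimalMomentum q Z Θ Y τ i ⟨Φ, h⟩) := by
  refine ⟨NAWarped.dense_tensorDomain_smoothDomain hZ m hO hOc hZO, fun i => ⟨fun α s => ?_,
    fun Φ hΦ => ?_⟩⟩
  · have hqc : (q : ℂ) ≠ 0 := by exact_mod_cast hq
    unfold NAWarped.gaugeField
    rw [smul_smul]
    congr 1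
    change -(q : ℂ) * ((-(NAWarped.gaugeFactor Z Θ i s) / q : ℝ) : ℂ) =
      ((NAWarped.gaugeFactor Z Θ i s : ℝ) : ℂ)
    push_cast
    field_simp
  · obtain ⟨h, hL, hR⟩ := NAWarped.deformed_momentum_eq hZ hO hOc hZO hq Θ Y τ hY i hΦ
    refine ⟨h, fun Ψ => ⟨⟨fun h' => ?_, fun e => e ▸ hL⟩, ⟨fun h' => ?_, fun e => e ▸ hR⟩⟩⟩
    -- The two domain proofs agree by proof irrelevance, so both limits belong to the same
    -- integrand.
    · obtain ⟨_, h1⟩ := h'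
      obtain ⟨_, h2⟩ := hL
      exact h1.unique h2
    · obtain ⟨_, h1⟩ := h'
      obtain ⟨_, h2⟩ := hR
      exact h1.unique h2
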